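/- Let $N\ge 2$, $1<p\le N$ and $0<r_1<r_2<R$. Write $B_R=\{x\in\mathbb R^N:|x|<R\}$ and $S=\{x\in\mathbb R^N: r_1<|x|<r_2\}$. Let $W^{1,p}_0(B_R)$ be the closure of $C^\infty_0(B_R)$ in $W^{1,p}(B_R)$, and let \[ \mathrm{cap}_p(\overline{B_{r_2}};B_R)=\inf\left\{\int_{B_R}|\nabla\varphi|^p\,dx\;:\;\varphi\in C^\infty_0(B_R),\ \varphi\ge 1\text{ on }\overline{B_{r_2}}\right\}. \] The problem \[ \min_{\varphi\in W^{1,p}_0(B_R)}\left\{\frac1p\int_{B_R}|\nabla\varphi|^p\,dx-\int_{S}\varphi\,dx\right\} \] has a unique minimizer $V$, and \[ \sup_{\varphi\in W^{1,p}_0(B_R)\setminus\{0\}}\frac{\left(\int_{S}|\varphi|\,dx\right)^p}{\int_{B_R}|\nabla\varphi|^p\,dx}=\left(\int_{B_R}|\nabla V|^p\,dx\right)^{p-1}, \] where \[ \int_{B_R}|\nabla V|^p\,dx=\int_{S}\left(\frac{|x|}{N}\left(1-\left(\frac{r_1}{|x|}\right)^N\right)\right)^{\frac p{p-1}}dx+|S|^{\frac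 p{p-1}}\left(\frac1{\mathrm{cap}_p(\overline{B_{r_2}};B_R)}\right)^{\frac1{p-1}}. \] In particular, for every $\varphi\in W^{1,p}_0(B_R)$, with $\mathcal H^{N-1}$ the $(N-1)$-dimensional Hausdorff measure (surface area), \[ \left(\frac{1}{|S|}\int_{S}|\varphi|\,dx\right)^p\le\left[\frac{|S|}{\left(\mathcal H^{N-1}(\partial B_{r_2})\right)^{\frac p{p-1}}}+\left(\frac1{\mathrm{cap}_p(\overline{B_{r_2}};B_R)}\right)^{\frac1{p-1}}\right]^{p-1}\int_{B_R}|\nabla\varphi|^p\,dx. \] -/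

import Mathlib

open MeasureTheory Metric Set
open scoped ContDiff Gradient ENNReal

noncomputable section

/-- `φ ∈ C^∞_0(Ω)`: smooth with compact support contained in `Ω`. -/
def IsTestFunction {N : ℕ} (Ω : Set (EuclideanSpace ℝ (Fin N)))
    (φ : EuclideanSpace ℝ (Fin N) → ℝ) : Prop :=
  ContDiff ℝ ∞ φ ∧ HasCompactSupport φ ∧ tsupport φ ⊆ Ω

/-- `G` is the weak (distributional) gradient of `u` on the open set `Ω`. Only the values of `u` and
`G` on `Ω` matter. -/
def IsWeakGradient {N : ℕ} (Ω : Set (EuclideanSpace ℝ (Fin N)))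
    (u : EuclideanSpace ℝ (Fin N) → ℝ)
    (G : EuclideanSpace ℝ (Fin N) → EuclideanSpace ℝ (Fin N)) : Prop :=
  LocallyIntegrableOn u Ω ∧ LocallyIntegrableOn G Ω ∧
    ∀ φ : EuclideanSpace ℝ (Fin N) → ℝ, IsTestFunction Ω φ →
      (∫ x in Ω, u x • ∇ φ x) = - ∫ x in Ω, φ x • G x

/-- `u ∈ W^{1,p}(Ω)` with weak gradient `G`. -/
def MemSobolev {N : ℕ} (p : ℝ) (Ω : Set (EuclideanSpace ℝ (Fin N)))
    (u : EuclideanSpace ℝ (Fin N) → ℝ)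
    (G : EuclideanSpace ℝ (Fin N) → EuclideanSpace ℝ (Fin N)) : Prop :=
  MemLp u (ENNReal.ofReal p) (volume.restrict Ω) ∧
    MemLp G (ENNReal.ofReal p) (volume.restrict Ω) ∧ IsWeakGradient Ω u G

/-- `u ∈ W^{1,p}_0(Ω)` with weak gradient `G`: `u` lies in the closure of `C^∞_0(Ω)` in
`W^{1,p}(Ω)`. -/
def MemSobolevZero {N : ℕ} (p : ℝ) (Ω : Set (EuclideanSpace ℝ (Fin N)))
    (u : EuclideanSpace ℝ (Fin N) → ℝ)
    (G : EuclideanSpace ℝ (Fin N) → EuclideanSpace ℝ (Fin N)) : Prop :=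
  MemSobolev p Ω u G ∧
    ∀ ε : ℝ≥0∞, 0 < ε → ∃ φ : EuclideanSpace ℝ (Fin N) → ℝ, IsTestFunction Ω φ ∧
      eLpNorm (fun x => u x - φ x) (ENNReal.ofReal p) (volume.restrict Ω) +
        eLpNorm (fun x => G x - ∇ φ x) (ENNReal.ofReal p) (volume.restrict Ω) < ε

/-- The `p`-capacity of a compact set `K` relative to an open set `Ω ⊇ K`. The set whose infimum is
taken is then nonempty and bounded below by `0`. -/
def relCapacity {N : ℕ} (p : ℝ) (K Ω : Set (EuclideanSpace ℝ (Fin N))) : ℝ :=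
  sInf {c : ℝ | ∃ φ : EuclideanSpace ℝ (Fin N) → ℝ, IsTestFunction Ω φ ∧ (∀ x ∈ K, 1 ≤ φ x) ∧
    c = ∫ x in Ω, ‖∇ φ x‖ ^ p}

/-- The open spherical shell `{x : r₁ < |x| < r₂}`. -/
def shell (N : ℕ) (r₁ r₂ : ℝ) : Set (EuclideanSpace ℝ (Fin N)) :=
  {x | r₁ < ‖x‖ ∧ ‖x‖ < r₂}

/-- The functional `φ ↦ (1/p) ∫_{B_R} |∇φ|^p - ∫_S φ` with `S` the shell, where `G = ∇φ`. -/
def torsionFunctional {N : ℕ} (p r₁ r₂ R : ℝ) (φ : EuclideanSpace ℝ (Fin N) → ℝ)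
    (G : EuclideanSpace ℝ (Fin N) → EuclideanSpace ℝ (Fin N)) : ℝ :=
  (1 / p) * (∫ x in ball (0 : EuclideanSpace ℝ (Fin N)) R, ‖G x‖ ^ p) - ∫ x in shell N r₁ r₂, φ x

/-- `V`, with weak gradient `DV`, minimizes the torsion functional over `W^{1,p}_0(B_R)`. -/
def IsTorsionMinimizer {N : ℕ} (p r₁ r₂ R : ℝ) (V : EuclideanSpace ℝ (Fin N) → ℝ)
    (DV : EuclideanSpace ℝ (Fin N) → EuclideanSpace ℝ (Fin N)) : Prop :=
  MemSobolevZero p (ball 0 R) V DV ∧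
    ∀ (φ : EuclideanSpace ℝ (Fin N) → ℝ)
      (Dφ : EuclideanSpace ℝ (Fin N) → EuclideanSpace ℝ (Fin N)), MemSobolevZero p (ball 0 R) φ Dφ →
      torsionFunctional p r₁ r₂ R V DV ≤ torsionFunctional p r₁ r₂ R φ Dφ

end

/-! The radial field `X` with divergence the indicator function of `S` and no flux through `∂B_r`
for `r ≤ r₁` satisfies `∫_S φ = -∫ ⟪∇φ, X⟫` for every `φ ∈ W^{1,p}_0(B_R)`, with no boundary
condition on `X`. Hölder's inequality therefore bounds the quotient by `(∫ |X|^{p/(p-1)})^{p-1}`,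
and Young's inequality bounds the torsion functional below by `-(1 - 1/p) ∫ |X|^{p/(p-1)}`.
Equality in Young's inequality prescribes `∇V` as the vector of modulus `|X|^{1/(p-1)}` in the
direction of `-X`; since it is radial, it is the gradient of an element of `W^{1,p}_0(B_R)`,
which is thus the unique minimizer and attains the supremum.

Outside `B_{r₂}` the field is `|S| / |∂B_r|` times the outward unit normal, so the corresponding
part of the energy is `|S|^{p/(p-1)} ∫_{r₂}^R |∂B_r|^{-1/(p-1)} dr`. That last integral is
`cap_p^{-1/(p-1)}`: radial competitors give one inequality, and the averaged inequality on the
shell `{c < |x| < r₂}`, with `c ↑ r₂`, gives the other. -/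

section SphereMeasure

open Module NormedSpace
open scoped NNReal Pointwise RealInnerProductSpace Topology

theorem measure_le_of_forall_subset_closedBall {X : Type*} [PseudoMetricSpace X]
    [SecondCountableTopology X] [MeasurableSpace X] [OpensMeasurableSpace X] {μ ν : Measure X}
    {r : ℝ} (hr : 0 < r)
    (h : ∀ x, ∀ s ⊆ closedBall x r, MeasurableSet s → μ s ≤ ν s) : μ ≤ ν := by
  rcases isEmpty_or_nonempty X with hX | hX
  · simp [Measure.eq_zero_of_isEmpty μ]
  set A : ℕ → Set X := disjointed fun n => ball (TopologicalSpace.denseSeq X n) r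
  have hA : ∀ n, MeasurableSet (A n) := .disjointed fun n => measurableSet_ball
  have hcover : ⋃ n, A n = univ := by
    rw [iUnion_disjointed]
    refine eq_univ_of_forall fun x => mem_iUnion.2 ?_
    obtain ⟨n, hn⟩ := (TopologicalSpace.denseRange_denseSeq X).exists_dist_lt x hr
    exact ⟨n, hn⟩
  refine Measure.le_iff.2 fun s hs => ?_
  have hdecomp : ∀ m : Measure X, m s = ∑' n, m (s ∩ A n) := fun m => by
    rw [← measure_iUnion (fun i j hij => ((disjoint_disjointed _) hij).mono inter_subset_right
      inter_subset_right) fun n => hs.inter (hA n), ← inter_iUnion, hcover, inter_univ]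
  rw [hdecomp μ, hdecomp ν]
  exact ENNReal.tsum_le_tsum fun n => h _ _ (inter_subset_right.trans
    ((disjointed_subset _ n).trans ball_subset_closedBall)) (hs.inter (hA n))

theorem euclideanHausdorffMeasure_image_le {X Y : Type*} [EMetricSpace X]
    [MeasurableSpace X] [BorelSpace X] [EMetricSpace Y] [MeasurableSpace Y] [BorelSpace Y]
    {f : X → Y} {s : Set X} (hf : LipschitzOnWith 1 f s) (d : ℕ) :
    μHE[d] (f '' s) ≤ μHE[d] s := by
  have := hf.hausdorffMeasure_image_le (d := (d : ℝ)) (by positivity)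
  simp only [ENNReal.coe_one, ENNReal.one_rpow, one_mul] at this
  simp only [Measure.euclideanHausdorffMeasure_def, Measure.smul_apply]
  gcongr

variable {E : Type*} [NormedAddCommGroup E] [InnerProductSpace ℝ E]

theorem norm_sub_sq_eq_add_mul_norm_normalize_sub_sq {x y : E} (hx : x ≠ 0) (hy : y ≠ 0) :
    ‖x - y‖ ^ 2 = (‖x‖ - ‖y‖) ^ 2 +
      ‖x‖ * ‖y‖ * ‖NormedSpace.normalize x - NormedSpace.normalize y‖ ^ 2 := by
  have hxy : ‖x‖ ≠ 0 ∧ ‖y‖ ≠ 0 := ⟨norm_ne_zero_iff.2 hx, norm_ne_zero_iff.2 hy⟩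
  rw [norm_sub_sq_real, norm_sub_sq_real, norm_normalize hx, norm_normalize hy,
    NormedSpace.normalize, NormedSpace.normalize, real_inner_smul_left, real_inner_smul_right]
  field_simp [hxy.1, hxy.2]
  ring

theorem lipschitzOnWith_normalize :
    LipschitzOnWith 1 (NormedSpace.normalize : E → E) {x | 1 ≤ ‖x‖} := by
  refine LipschitzOnWith.of_dist_le_mul fun x (hx : 1 ≤ ‖x‖) y (hy : 1 ≤ ‖y‖) => ?_
  rw [NNReal.coe_one, one_mul, dist_eq_norm, dist_eq_norm]
  refine le_of_sq_le_sq ?_ (norm_nonneg _)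
  rw [norm_sub_sq_eq_add_mul_norm_normalize_sub_sq (x := x) (y := y)
    (norm_pos_iff.1 (by linarith)) (norm_pos_iff.1 (by linarith))]
  nlinarith [sq_nonneg (‖x‖ - ‖y‖), one_le_mul_of_one_le_of_one_le hx hy,
    sq_nonneg ‖NormedSpace.normalize x - NormedSpace.normalize y‖]

theorem one_sub_sq_div_two_le_inner {x v : E} {r : ℝ} (hx : ‖x‖ = 1) (hv : ‖v‖ = 1)
    (h : x ∈ closedBall v r) : 1 - r ^ 2 / 2 ≤ ⟪x, v⟫ := by
  rw [mem_closedBall, dist_eq_norm] at h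
  have := norm_sub_sq_real x v
  rw [hx, hv] at this
  nlinarith [pow_le_pow_left₀ (norm_nonneg _) h 2]

/-- The central projection of a subset `s` of the unit sphere to the hyperplane touching the sphere
at `v`. -/
def gnomonicLift (v : E) (s : Set E) : Set E := {z | ⟪z, v⟫ = 1 ∧ NormedSpace.normalize z ∈ s}

variable {v : E} {s : Set E} {c : ℝ}

theorem one_le_norm_of_mem_gnomonicLift (hv : ‖v‖ = 1) {z : E} (hz : z ∈ gnomonicLift v s) :
    1 ≤ ‖z‖ := by
  simpa [hz.1, hv] using real_inner_le_norm z v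

theorem mul_norm_le_one_of_mem_gnomonicLift (hsv : ∀ y ∈ s, c ≤ ⟪y, v⟫) {z : E}
    (hz : z ∈ gnomonicLift v s) : c * ‖z‖ ≤ 1 := by
  calc c * ‖z‖ ≤ ⟪NormedSpace.normalize z, v⟫ * ‖z‖ := by gcongr; exact hsv _ hz.2
    _ = 1 := by rw [mul_comm, ← real_inner_smul_left, norm_smul_normalize, hz.1]

theorem subset_normalize_image_gnomonicLift (hs : s ⊆ sphere 0 1) (hsv : ∀ y ∈ s, 0 < ⟪y, v⟫) :
    s ⊆ NormedSpace.normalize '' gnomonicLift v s := by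
  intro y hy
  have hpos := hsv y hy
  have hnorm : NormedSpace.normalize ((⟪y, v⟫)⁻¹ • y) = y := by
    rw [normalize_smul_of_pos (inv_pos.2 hpos),
      normalize_eq_self_of_norm_eq_one (mem_sphere_zero_iff_norm.1 (hs hy))]
  refine ⟨(⟪y, v⟫)⁻¹ • y, ⟨?_, hnorm.symm ▸ hy⟩, hnorm⟩
  rw [real_inner_smul_left, inv_mul_cancel₀ hpos.ne']

theorem smul_gnomonicLift_subset (hv : ‖v‖ = 1) (hsv : ∀ y ∈ s, c ≤ ⟪y, v⟫) {t : ℝ}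
    (ht : t ∈ Ioo 0 c) :
    t • gnomonicLift v s ⊆
      Ioo (0 : ℝ) 1 • s ∩ AffineSubspace.mk' (t • v +ᵥ (0 : E)) (ℝ ∙ v)ᗮ := by
  rintro _ ⟨z, hz, rfl⟩
  have hz1 := one_le_norm_of_mem_gnomonicLift hv hz
  have hzc := mul_norm_le_one_of_mem_gnomonicLift hsv hz
  have hmem : t * ‖z‖ ∈ Ioo (0 : ℝ) 1 :=
    ⟨mul_pos ht.1 (one_pos.trans_le hz1), by nlinarith [ht.2]⟩
  refine ⟨⟨t * ‖z‖, hmem, NormedSpace.normalize z, hz.2, ?_⟩, ?_⟩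
  · simp only [mul_smul, norm_smul_normalize]
  · simp only [vadd_eq_add, add_zero, SetLike.mem_coe, AffineSubspace.mem_mk', vsub_eq_sub]
    rw [Submodule.mem_orthogonal_singleton_iff_inner_left, ← smul_sub, real_inner_smul_left,
      inner_sub_left, hz.1, real_inner_self_eq_norm_sq, hv]
    simp

theorem Ioo_smul_eq_of_subset_sphere (hs : s ⊆ sphere 0 1) :
    Ioo (0 : ℝ) 1 • s = {y | y ≠ 0 ∧ ‖y‖ < 1 ∧ NormedSpace.normalize y ∈ s} := by
  ext y
  refine ⟨?_, fun ⟨h0, h1, h2⟩ =>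
    ⟨‖y‖, ⟨norm_pos_iff.2 h0, h1⟩, NormedSpace.normalize y, h2, norm_smul_normalize y⟩⟩
  rintro ⟨t, ht, x, hx, rfl⟩
  have hx1 : ‖x‖ = 1 := mem_sphere_zero_iff_norm.1 (hs hx)
  refine ⟨smul_ne_zero ht.1.ne' (norm_pos_iff.1 (hx1 ▸ one_pos)), ?_, ?_⟩
  · simpa [norm_smul, hx1, abs_of_pos ht.1] using ht.2
  · simpa only [normalize_smul_of_pos ht.1, normalize_eq_self_of_norm_eq_one hx1] using hx

theorem finrank_orthogonal_span_singleton_eq [FiniteDimensional ℝ E] (hv : v ≠ 0) :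
    finrank ℝ (ℝ ∙ v)ᗮ = finrank ℝ E - 1 := by
  have := (ℝ ∙ v).finrank_add_finrank_orthogonal
  rw [finrank_span_singleton hv] at this
  omega

theorem ball_subset_orthogonalProjectionOnto_image_sphere (hv : ‖v‖ = 1) :
    ball 0 1 ⊆ (ℝ ∙ v)ᗮ.orthogonalProjectionOnto '' sphere (0 : E) 1 := by
  intro w hw
  have hw1 : ‖(w : E)‖ < 1 := by simpa using hw
  have hwv : ⟪(w : E), v⟫ = 0 := Submodule.mem_orthogonal_singleton_iff_inner_left.1 w.2
  refine ⟨(w : E) + √(1 - ‖(w : E)‖ ^ 2) • v, ?_, ?_⟩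
  · rw [mem_sphere_zero_iff_norm, ← sq_eq_sq₀ (norm_nonneg _) zero_le_one, norm_add_sq_real,
      real_inner_smul_right, hwv, norm_smul, hv, mul_one, Real.norm_eq_abs, sq_abs,
      Real.sq_sqrt (by nlinarith [norm_nonneg (w : E)])]
    ring
  · rw [map_add, map_smul,
      Submodule.orthogonalProjectionOnto_orthogonalComplement_singleton_eq_zero, smul_zero,
      add_zero]
    exact Submodule.orthogonalProjectionOnto_mem_subspace_eq_self w

variable [MeasurableSpace E] [BorelSpace E]

theorem measurableSet_Ioo_smul_of_subset_sphere [SecondCountableTopology E] (hs : s ⊆ sphere 0 1)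
    (hms : MeasurableSet s) : MeasurableSet (Ioo (0 : ℝ) 1 • s) := by
  rw [Ioo_smul_eq_of_subset_sphere hs]
  exact (measurableSet_singleton (0 : E)).compl.inter
    ((measurableSet_lt measurable_norm measurable_const).inter
      ((measurable_norm.inv.smul measurable_id) hms))

theorem euclideanHausdorffMeasure_le_gnomonicLift (hv : ‖v‖ = 1) (hs : s ⊆ sphere 0 1)
    (hsv : ∀ y ∈ s, 0 < ⟪y, v⟫) (d : ℕ) : μHE[d] s ≤ μHE[d] (gnomonicLift v s) :=
  (measure_mono (subset_normalize_image_gnomonicLift hs hsv)).trans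
    (euclideanHausdorffMeasure_image_le
      (lipschitzOnWith_normalize.mono fun _ => one_le_norm_of_mem_gnomonicLift hv) d)

theorem euclideanHausdorffMeasure_real_sphere_eq {r : ℝ} (hr : 0 < r) (d : ℕ) :
    (μHE[d] : Measure E).real (sphere (0 : E) r) =
      r ^ d * (μHE[d] : Measure E).real (sphere (0 : E) 1) := by
  have : sphere (0 : E) r = r • sphere (0 : E) 1 := by
    rw [smul_sphere' hr.ne', smul_zero, Real.norm_of_nonneg hr.le, mul_one]
  rw [this, Measure.real, Measure.euclideanHausdorffMeasure_smul₀ d hr.ne', ENNReal.smul_def,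
    smul_eq_mul, ENNReal.toReal_mul, Measure.real]
  simp [abs_of_pos hr]

theorem lintegral_ofReal_pow (n : ℕ) (hc : 0 ≤ c) :
    ∫⁻ t in Ioo 0 c, ENNReal.ofReal (t ^ n) = ENNReal.ofReal (c ^ (n + 1) / (n + 1)) := by
  rw [restrict_Ioo_eq_restrict_Ioc,
    ← ofReal_integral_eq_lintegral_ofReal (intervalIntegral.intervalIntegrable_pow _).1
      (ae_restrict_of_forall_mem measurableSet_Ioc fun t ht => pow_nonneg ht.1.le n),
    ← intervalIntegral.integral_of_le hc, integral_pow]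
  simp

variable [FiniteDimensional ℝ E]

theorem lintegral_slice_le_volume_Ioo_smul (hv : ‖v‖ = 1) (hs : s ⊆ sphere 0 1)
    (hms : MeasurableSet s) (hsv : ∀ y ∈ s, c ≤ ⟪y, v⟫) :
    (∫⁻ t in Ioo 0 c, ENNReal.ofReal (t ^ (finrank ℝ E - 1))) *
        μHE[finrank ℝ E - 1] (gnomonicLift v s) ≤ volume (Ioo (0 : ℝ) 1 • s) := by
  have hv0 : v ≠ 0 := norm_pos_iff.1 (hv ▸ one_pos)
  have hslice : volume (Ioo (0 : ℝ) 1 • s) = ∫⁻ t : ℝ, μHE[finrank ℝ E - 1]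
      (Ioo (0 : ℝ) 1 • s ∩ AffineSubspace.mk' (t • v +ᵥ (0 : E)) (ℝ ∙ v)ᗮ) := by
    rw [← InnerProductSpace.euclideanHausdorffMeasure_eq_volume,
      EuclideanGeometry.euclideanHausdorffMeasure_eq_lintegral (0 : E) hv0
        (measurableSet_Ioo_smul_of_subset_sphere hs hms), ← ofReal_norm, hv, ENNReal.ofReal_one,
      one_mul]
  rw [hslice, ← lintegral_mul_const _ (by fun_prop)]
  refine (setLIntegral_mono' measurableSet_Ioo fun t ht => ?_).trans
    (setLIntegral_le_lintegral _ _)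
  refine le_of_eq_of_le ?_ (measure_mono (smul_gnomonicLift_subset hv hsv ht))
  rw [Measure.euclideanHausdorffMeasure_smul₀ _ ht.1.ne', ENNReal.smul_def, smul_eq_mul,
    ENNReal.coe_pow, ENNReal.ofReal_pow ht.1.le, ← enorm_eq_nnnorm, Real.enorm_eq_ofReal ht.1.le]

theorem euclideanHausdorffMeasure_cap_le (hv : ‖v‖ = 1) (hs : s ⊆ sphere 0 1)
    (hms : MeasurableSet s) (hc : 0 < c) (hsv : ∀ y ∈ s, c ≤ ⟪y, v⟫) :
    ENNReal.ofReal (c ^ finrank ℝ E) * μHE[finrank ℝ E - 1] s ≤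
      finrank ℝ E * volume (Ioo (0 : ℝ) 1 • s) := by
  have : Nontrivial E := ⟨v, 0, norm_pos_iff.1 (hv ▸ one_pos)⟩
  obtain ⟨n, hn⟩ := Nat.exists_eq_add_one.2 (finrank_pos (R := ℝ) (M := E))
  have hcone := lintegral_slice_le_volume_Ioo_smul hv hs hms hsv
  have hlift := euclideanHausdorffMeasure_le_gnomonicLift hv hs (fun y hy => hc.trans_le (hsv y hy))
    (finrank ℝ E - 1)
  simp only [hn, Nat.add_sub_cancel] at hcone hlift ⊢
  calc ENNReal.ofReal (c ^ (n + 1)) * μHE[n] s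
      = ((n + 1 : ℕ) : ℝ≥0∞) * ((∫⁻ t in Ioo 0 c, ENNReal.ofReal (t ^ n)) * μHE[n] s) := by
        rw [lintegral_ofReal_pow n hc.le, ← mul_assoc, ← ENNReal.ofReal_natCast,
          ← ENNReal.ofReal_mul (by positivity), Nat.cast_add_one,
          mul_div_cancel₀ _ (by positivity)]
    _ ≤ ((n + 1 : ℕ) : ℝ≥0∞) * volume (Ioo (0 : ℝ) 1 • s) := by
        gcongr
        exact le_trans (by gcongr) hcone

theorem smul_comap_euclideanHausdorffMeasure_le_toSphere {r : ℝ} (hr : r ∈ Ioo 0 1) :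
    ENNReal.ofReal ((1 - r ^ 2 / 2) ^ finrank ℝ E) •
        (μHE[finrank ℝ E - 1]).comap ((↑) : sphere (0 : E) 1 → E) ≤
      (volume : Measure E).toSphere := by
  refine measure_le_of_forall_subset_closedBall hr.1 fun v s hsv hs => ?_
  have hsphere : MeasurableSet (sphere (0 : E) 1) := isClosed_sphere.measurableSet
  rw [Measure.smul_apply, smul_eq_mul, comap_subtype_coe_apply hsphere,
    Measure.toSphere_apply' _ hs]
  have hcap : ∀ y ∈ ((↑) '' s : Set E), 1 - r ^ 2 / 2 ≤ ⟪y, (v : E)⟫ := by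
    rintro _ ⟨y, hy, rfl⟩
    exact one_sub_sq_div_two_le_inner (norm_eq_of_mem_sphere y) (norm_eq_of_mem_sphere v) (hsv hy)
  exact euclideanHausdorffMeasure_cap_le (norm_eq_of_mem_sphere v) (Subtype.coe_image_subset _ _)
    (hsphere.subtype_image hs) (by nlinarith [hr.1, hr.2]) hcap

theorem euclideanHausdorffMeasure_unitSphere_le :
    μHE[finrank ℝ E - 1] (sphere (0 : E) 1) ≤ finrank ℝ E * volume (ball (0 : E) 1) := by
  have hlim : Filter.Tendsto (fun r : ℝ => ENNReal.ofReal ((1 - r ^ 2 / 2) ^ finrank ℝ E) *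
      μHE[finrank ℝ E - 1] (sphere (0 : E) 1)) (𝓝[>] 0)
      (𝓝 (μHE[finrank ℝ E - 1] (sphere (0 : E) 1))) := by
    have hone : Filter.Tendsto (fun r : ℝ => ENNReal.ofReal ((1 - r ^ 2 / 2) ^ finrank ℝ E))
        (𝓝[>] 0) (𝓝 1) := by
      exact ((ENNReal.continuous_ofReal.comp (by fun_prop)).tendsto' 0 1 (by simp)).mono_left
        nhdsWithin_le_nhds
    simpa using ENNReal.Tendsto.mul_const hone (.inl one_ne_zero)
  refine le_of_tendsto hlim ?_
  filter_upwards [Ioo_mem_nhdsGT one_pos] with r hr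
  have := smul_comap_euclideanHausdorffMeasure_le_toSphere (E := E) hr univ
  rwa [Measure.smul_apply, smul_eq_mul, comap_subtype_coe_apply isClosed_sphere.measurableSet,
    image_univ, Subtype.range_coe, Measure.toSphere_apply_univ] at this

theorem euclideanHausdorffMeasure_unitSphere_pos [Nontrivial E] :
    0 < μHE[finrank ℝ E - 1] (sphere (0 : E) 1) := by
  obtain ⟨v, hv⟩ := exists_norm_eq E (zero_le_one' ℝ)
  rw [← finrank_orthogonal_span_singleton_eq (norm_pos_iff.1 (hv ▸ one_pos))]
  calc 0 < μHE[finrank ℝ (ℝ ∙ v)ᗮ] (ball (0 : (ℝ ∙ v)ᗮ) 1) := by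
        rw [InnerProductSpace.euclideanHausdorffMeasure_eq_volume]
        exact measure_ball_pos _ _ one_pos
    _ ≤ _ := measure_mono (ball_subset_orthogonalProjectionOnto_image_sphere hv)
    _ ≤ _ := euclideanHausdorffMeasure_image_le
        (Submodule.lipschitzWith_orthogonalProjectionOnto _).lipschitzOnWith _

/-- The area of the sphere of radius `r` about the origin, as the derivative of the volume of the
ball; `euclideanHausdorffMeasure_real_sphere_mem_Ioc` compares it with the Hausdorff measure. -/
noncomputable def sphereArea (E : Type*) [NormedAddCommGroup E] [InnerProductSpace ℝ E]
    [FiniteDimensional ℝ E] [MeasurableSpace E] [BorelSpace E] (r : ℝ) : ℝ :=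
  finrank ℝ E * volume.real (ball (0 : E) 1) * r ^ (finrank ℝ E - 1)

theorem euclideanHausdorffMeasure_real_sphere_mem_Ioc [Nontrivial E] {r : ℝ} (hr : 0 < r) :
    (μHE[finrank ℝ E - 1] : Measure E).real (sphere (0 : E) r) ∈ Ioc 0 (sphereArea E r) := by
  have hle := euclideanHausdorffMeasure_unitSphere_le (E := E)
  have hpos := euclideanHausdorffMeasure_unitSphere_pos (E := E)
  have hfin : (finrank ℝ E : ℝ≥0∞) * volume (ball (0 : E) 1) ≠ ⊤ :=
    ENNReal.mul_ne_top (by simp) measure_ball_lt_top.ne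
  rw [euclideanHausdorffMeasure_real_sphere_eq hr]
  constructor
  · have := ENNReal.toReal_pos hpos.ne' (ne_top_of_le_ne_top hfin hle)
    rw [Measure.real]
    positivity
  · rw [sphereArea, mul_comm]
    gcongr
    simpa [Measure.real] using ENNReal.toReal_mono hfin hle

end SphereMeasure
section PolarCoordinates

open Module

variable {E F : Type*} [NormedAddCommGroup E] [NormedSpace ℝ E] [MeasurableSpace E] [BorelSpace E]
  [FiniteDimensional ℝ E] [Nontrivial E] [NormedAddCommGroup F] [NormedSpace ℝ F]
  (μ : Measure E) [μ.IsAddHaarMeasure]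

theorem integral_eq_integral_toSphere_integral_Ioi {f : E → F} (hf : Integrable f μ) :
    ∫ x, f x ∂μ =
      ∫ θ : sphere (0 : E) 1, (∫ r in Ioi (0 : ℝ), r ^ (finrank ℝ E - 1) • f (r • (θ : E)))
        ∂μ.toSphere := by
  have hsymm : ∀ z, ((homeomorphUnitSphereProd E).symm z : E) = (z.2 : ℝ) • (z.1 : E) :=
    homeomorphUnitSphereProd_symm_apply_coe E
  have hmp := (μ.measurePreserving_homeomorphUnitSphereProd.symm
    (homeomorphUnitSphereProd E).toMeasurableEquiv)
  have hemb := (homeomorphUnitSphereProd E).symm.measurableEmbedding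
  have hint : Integrable (fun z : sphere (0 : E) 1 × Ioi (0 : ℝ) => f ((z.2 : ℝ) • (z.1 : E)))
      (μ.toSphere.prod (.volumeIoiPow (finrank ℝ E - 1))) := by
    simp only [← hsymm]
    refine (hmp.integrable_comp_emb hemb (g := fun x => f (x : E))).2 ?_
    exact (integrableOn_iff_comap_subtypeVal (measurableSet_singleton _).compl).1 hf.integrableOn
  calc ∫ x, f x ∂μ = ∫ x : ({(0)}ᶜ : Set E), f x ∂(μ.comap (↑)) := by
        rw [integral_subtype_comap (measurableSet_singleton _).compl, restrict_compl_singleton]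
    _ = ∫ z : sphere (0 : E) 1 × Ioi (0 : ℝ), f ((z.2 : ℝ) • (z.1 : E))
          ∂μ.toSphere.prod (.volumeIoiPow (finrank ℝ E - 1)) := by
        simp only [← hsymm]
        exact (hmp.integral_comp hemb (fun x => f (x : E))).symm
    _ = ∫ θ : sphere (0 : E) 1, (∫ r : Ioi (0 : ℝ), f ((r : ℝ) • (θ : E))
          ∂.volumeIoiPow (finrank ℝ E - 1)) ∂μ.toSphere := integral_prod _ hint
    _ = _ := by
        refine integral_congr_ae (.of_forall fun θ => ?_)
        simp only [Measure.volumeIoiPow, ENNReal.ofReal]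
        rw [integral_withDensity_eq_integral_smul
            (measurable_subtype_coe.pow_const _).real_toNNReal,
          integral_subtype_comap measurableSet_Ioi
            fun r : ℝ => Real.toNNReal (r ^ (finrank ℝ E - 1)) • f (r • (θ : E))]
        refine setIntegral_congr_fun measurableSet_Ioi fun r hr => ?_
        rw [NNReal.smul_def, Real.coe_toNNReal _ (pow_nonneg hr.out.le _)]

end PolarCoordinates

section Flux

open Module Filter
open scoped Topology RealInnerProductSpace

/-- The mass of the shell `{a < |x| < b}` lying within distance `r` of the origin, divided by the
area of the sphere of radius `r` in dimension `n`: the outward flux density on that sphere of a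
radial field with divergence the indicator function of the shell. -/
noncomputable def shellFlux (n : ℕ) (a b r : ℝ) : ℝ :=
  (max a (min r b) ^ n - a ^ n) / (n * r ^ (n - 1))

variable {n : ℕ} {a b r : ℝ}

@[fun_prop]
theorem measurable_shellFlux : Measurable (shellFlux n a b) := by
  unfold shellFlux
  fun_prop

theorem shellFlux_of_le (h : r ≤ a) : shellFlux n a b r = 0 := by
  simp [shellFlux, (min_le_left r b).trans h]

theorem shellFlux_nonneg (ha : 0 ≤ a) (hr : 0 ≤ r) : 0 ≤ shellFlux n a b r :=
  div_nonneg (sub_nonneg.2 (pow_le_pow_left₀ ha (le_max_left _ _) n)) (by positivity)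

theorem shellFlux_le_self (hn : n ≠ 0) (ha : 0 ≤ a) (hr : 0 ≤ r) : shellFlux n a b r ≤ r := by
  rcases le_or_gt r a with h | h
  · rwa [shellFlux_of_le h]
  have hr' : 0 < r := ha.trans_lt h
  have hn' : (1 : ℝ) ≤ n := Nat.one_le_cast.2 (Nat.one_le_iff_ne_zero.2 hn)
  rw [shellFlux, div_le_iff₀ (by positivity)]
  calc max a (min r b) ^ n - a ^ n ≤ r ^ n := by
        have : max a (min r b) ^ n ≤ r ^ n :=
          pow_le_pow_left₀ (ha.trans (le_max_left _ _)) (max_le h.le (min_le_left _ _)) n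
        linarith [pow_nonneg ha n]
    _ ≤ n * r ^ n := le_mul_of_one_le_left (by positivity) hn'
    _ = r * (n * r ^ (n - 1)) := by rw [← mul_pow_sub_one hn r]; ring

theorem shellFlux_of_mem_Ioc (hn : n ≠ 0) (ha : 0 ≤ a) (hr : r ∈ Ioc a b) :
    shellFlux n a b r = r / n * (1 - (a / r) ^ n) := by
  have hr' : 0 < r := ha.trans_lt hr.1
  rw [shellFlux, min_eq_left hr.2, max_eq_right hr.1.le, div_pow, ← mul_pow_sub_one hn r]
  field_simp

theorem shellFlux_of_ge (hab : a ≤ b) (hr : b ≤ r) :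
    shellFlux n a b r = (b ^ n - a ^ n) / (n * r ^ (n - 1)) := by
  rw [shellFlux, min_eq_right hr, max_eq_right hab]

theorem hasDerivWithinAt_max_min_pow (n : ℕ) (a b r : ℝ) :
    HasDerivWithinAt (fun t => max a (min t b) ^ n)
      ((Ico a b).indicator (fun t => n * t ^ (n - 1)) r) (Ioi r) r := by
  by_cases hr : r ∈ Ico a b
  · rw [indicator_of_mem hr]
    refine (hasDerivAt_pow n r).hasDerivWithinAt.congr_of_eventuallyEq ?_ ?_
    · filter_upwards [Ioo_mem_nhdsGT hr.2] with t ht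
      rw [min_eq_left ht.2.le, max_eq_right (hr.1.trans ht.1.le)]
    · rw [min_eq_left hr.2.le, max_eq_right hr.1]
  · rw [indicator_of_notMem hr]
    rcases lt_or_ge r a with h | h
    · refine (hasDerivWithinAt_const r _ (a ^ n)).congr_of_eventuallyEq ?_ ?_
      · filter_upwards [Ioo_mem_nhdsGT h] with t ht
        rw [max_eq_left ((min_le_left _ _).trans ht.2.le)]
      · rw [max_eq_left ((min_le_left _ _).trans h.le)]
    · have hb : b ≤ r := not_lt.1 fun hb => hr ⟨h, hb⟩
      refine (hasDerivWithinAt_const r _ (max a b ^ n)).congr_of_eventuallyEq ?_ ?_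
      · filter_upwards [self_mem_nhdsWithin] with t (ht : r < t)
        rw [min_eq_right (hb.trans ht.le)]
      · rw [min_eq_right hb]

theorem pow_sub_one_mul_shellFlux (hr : 0 < r) :
    r ^ (n - 1) * shellFlux n a b r = (max a (min r b) ^ n - a ^ n) / n := by
  rw [shellFlux]
  field_simp

theorem integral_pow_mul_eq_neg_integral_shellFlux (hn : n ≠ 0) (ha : 0 ≤ a) {R : ℝ}
    (hR : 0 ≤ R) {f f' : ℝ → ℝ} (hf : ∀ r, HasDerivAt f (f' r) r) (hf' : Continuous f')
    (hfR : f R = 0) :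
    ∫ r in (0)..R, (Ico a b).indicator (fun r => r ^ (n - 1) * f r) r =
      -∫ r in (0)..R, r ^ (n - 1) * (shellFlux n a b r * f' r) := by
  set W : ℝ → ℝ := fun r => (max a (min r b) ^ n - a ^ n) / n
  set w : ℝ → ℝ := (Ico a b).indicator fun r => r ^ (n - 1)
  have hW0 : W 0 = 0 := by simp [W, (min_le_left 0 b).trans ha]
  have hW : ∀ r, HasDerivWithinAt W (w r) (Ioi r) r := fun r => by
    refine (((hasDerivWithinAt_max_min_pow n a b r).sub_const (a ^ n)).div_const n).congr_deriv ?_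
    by_cases hr : r ∈ Ico a b
    · simp [w, hr, hn]
    · simp [w, hr]
  have hw : IntervalIntegrable w volume 0 R :=
    (intervalIntegrable_iff.2 ((intervalIntegrable_iff.1
      (intervalIntegral.intervalIntegrable_pow _)).indicator measurableSet_Ico))
  have hparts := intervalIntegral.integral_mul_deriv_eq_deriv_mul_of_hasDeriv_right
    (u := W) (v := f) (by fun_prop) (fun r _ => (hf r).continuousAt.continuousWithinAt)
    (fun r _ => hW r) (fun r _ => (hf r).hasDerivWithinAt) hw (hf'.intervalIntegrable 0 R)
  rw [hW0, hfR, mul_zero, zero_mul, sub_zero, zero_sub] at hparts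
  calc ∫ r in (0)..R, (Ico a b).indicator (fun r => r ^ (n - 1) * f r) r
      = ∫ r in (0)..R, w r * f r := by simp only [w, indicator_mul_left]
    _ = -∫ r in (0)..R, W r * f' r := by rw [hparts, neg_neg]
    _ = _ := by
      refine congr_arg Neg.neg (intervalIntegral.integral_congr_ae (.of_forall fun r hr => ?_))
      rw [uIoc_of_le hR] at hr
      rw [← mul_assoc, pow_sub_one_mul_shellFlux hr.1]

theorem integral_Ioi_pow_mul_eq_neg_integral_shellFlux (hn : n ≠ 0) (ha : 0 ≤ a) {R : ℝ}
    (hR : 0 ≤ R) {f f' : ℝ → ℝ} (hf : ∀ r, HasDerivAt f (f' r) r) (hf' : Continuous f')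
    (hfR : ∀ r ≥ R, f r = 0) :
    ∫ r in Ioi (0 : ℝ), r ^ (n - 1) * (Ioo a b).indicator f r =
      -∫ r in Ioi (0 : ℝ), r ^ (n - 1) * (shellFlux n a b r * f' r) := by
  have hfR' : ∀ r > R, f' r = 0 := fun r hr => by
    refine (hf r).unique ((hasDerivAt_const r (0 : ℝ)).congr_of_eventuallyEq ?_)
    filter_upwards [Ioi_mem_nhds hr] with t ht using hfR t (le_of_lt ht)
  have hcut : ∀ {g : ℝ → ℝ}, (∀ r > R, g r = 0) → ∫ r in Ioi 0, g r = ∫ r in (0)..R, g r :=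
    fun {g} hg => by
      rw [intervalIntegral.integral_of_le hR]
      refine setIntegral_eq_of_subset_of_forall_sdiff_eq_zero measurableSet_Ioi
        Ioc_subset_Ioi_self fun r hr => hg r ?_
      exact not_le.1 fun h => hr.2 ⟨hr.1, h⟩
  rw [hcut fun r hr => by simp [hfR r hr.le, indicator], hcut fun r hr => by simp [hfR' r hr],
    ← integral_pow_mul_eq_neg_integral_shellFlux hn ha hR hf hf' (hfR R le_rfl)]
  refine intervalIntegral.integral_congr_ae ?_
  filter_upwards [indicator_ae_eq_of_ae_eq_set (f := f) (Ioo_ae_eq_Ico (a := a) (b := b))]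
    with r hr _
  rw [hr, indicator_mul_right]

variable {N : ℕ}

/-- The radial vector field with divergence the indicator function of `shell N a b` that vanishes
for `|x| ≤ a`. -/
noncomputable def fluxField (N : ℕ) (a b : ℝ) (x : EuclideanSpace ℝ (Fin N)) :
    EuclideanSpace ℝ (Fin N) :=
  shellFlux N a b ‖x‖ • NormedSpace.normalize x

@[fun_prop]
theorem measurable_fluxField : Measurable (fluxField N a b) :=
  (measurable_shellFlux.comp measurable_norm).smul (measurable_norm.inv.smul measurable_id)

theorem norm_fluxField (ha : 0 ≤ a) (x : EuclideanSpace ℝ (Fin N)) :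
    ‖fluxField N a b x‖ = shellFlux N a b ‖x‖ := by
  rcases eq_or_ne x 0 with rfl | hx
  · simp [fluxField, shellFlux_of_le ha]
  · rw [fluxField, norm_smul, NormedSpace.norm_normalize hx, mul_one,
      Real.norm_of_nonneg (shellFlux_nonneg ha (norm_nonneg x))]

theorem norm_fluxField_le [NeZero N] (ha : 0 ≤ a) (x : EuclideanSpace ℝ (Fin N)) :
    ‖fluxField N a b x‖ ≤ ‖x‖ :=
  (norm_fluxField ha x).trans_le (shellFlux_le_self (NeZero.ne N) ha (norm_nonneg x))

theorem measurableSet_shell (a b : ℝ) : MeasurableSet (shell N a b) :=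
  (measurableSet_lt measurable_const measurable_norm).inter
    (measurableSet_lt measurable_norm measurable_const)

section Integrable

variable [NeZero N] (ha : 0 ≤ a) {G : EuclideanSpace ℝ (Fin N) → EuclideanSpace ℝ (Fin N)}
  (hG : Continuous G) (hGc : HasCompactSupport G)

include ha hG hGc

theorem integrable_norm_mul_norm_fluxField : Integrable fun x => ‖G x‖ * ‖fluxField N a b x‖ := by
  have hbound : Integrable fun x => ‖G x‖ * ‖x‖ :=
    (by fun_prop : Continuous fun x => ‖G x‖ * ‖x‖).integrable_of_hasCompactSupport
      (hGc.norm.mul_right (f' := fun x => ‖x‖))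
  refine hbound.mono' (by fun_prop) (.of_forall fun x => ?_)
  rw [norm_mul, norm_norm, norm_norm]
  gcongr
  exact norm_fluxField_le ha x

theorem integrable_inner_fluxField : Integrable fun x => ⟪G x, fluxField N a b x⟫ :=
  (integrable_norm_mul_norm_fluxField ha hG hGc).mono' (by fun_prop)
    (.of_forall fun _ => norm_inner_le_norm _ _)

end Integrable

variable {φ : EuclideanSpace ℝ (Fin N) → ℝ}

theorem continuous_gradient_of_contDiff (hφ : ContDiff ℝ 1 φ) : Continuous (∇ φ) :=
  (InnerProductSpace.toDual ℝ _).symm.continuous.comp (hφ.continuous_fderiv one_ne_zero)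

theorem hasCompactSupport_gradient (hφ : HasCompactSupport φ) : HasCompactSupport (∇ φ) :=
  (hφ.fderiv (𝕜 := ℝ)).comp_left (g := (InnerProductSpace.toDual ℝ _).symm) (map_zero _)

theorem integral_ray_eq_neg_integral_ray_inner_fluxField [NeZero N] (ha : 0 ≤ a)
    (hφ : ContDiff ℝ 1 φ) (hφc : HasCompactSupport φ) {θ : EuclideanSpace ℝ (Fin N)}
    (hθ : ‖θ‖ = 1) :
    ∫ r in Ioi (0 : ℝ), r ^ (N - 1) * (shell N a b).indicator φ (r • θ) =
      -∫ r in Ioi (0 : ℝ), r ^ (N - 1) * ⟪∇ φ (r • θ), fluxField N a b (r • θ)⟫ := by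
  obtain ⟨R, hR0, hR⟩ := hφc.isCompact.isBounded.exists_pos_norm_lt
  have hnorm : ∀ {r : ℝ}, 0 < r → ‖r • θ‖ = r := fun hr => by
    rw [norm_smul, hθ, mul_one, Real.norm_of_nonneg hr.le]
  have hout : ∀ r, R ≤ r → φ (r • θ) = 0 := fun r hr => image_eq_zero_of_notMem_tsupport fun hmem =>
    absurd (hnorm (hR0.trans_le hr) ▸ hR _ hmem) hr.not_gt
  have hray : ∀ r : ℝ, HasDerivAt (fun r : ℝ => φ (r • θ)) (fderiv ℝ φ (r • θ) θ) r := fun r => by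
    have hline : HasDerivAt (fun r : ℝ => r • θ) θ r := by
      simpa using (hasDerivAt_id r).smul_const θ
    exact (hφ.differentiable one_ne_zero (r • θ)).hasFDerivAt.comp_hasDerivAt r hline
  have hparts := integral_Ioi_pow_mul_eq_neg_integral_shellFlux (b := b) (NeZero.ne N) ha hR0.le
    hray (((hφ.continuous_fderiv one_ne_zero).comp (by fun_prop)).clm_apply continuous_const) hout
  convert hparts using 1
  · refine setIntegral_congr_fun measurableSet_Ioi fun r (hr : 0 < r) => ?_
    have hmem : r • θ ∈ shell N a b ↔ r ∈ Ioo a b := by simp [shell, hnorm hr]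
    simp only [indicator, hmem]
  · refine congr_arg Neg.neg (setIntegral_congr_fun measurableSet_Ioi fun r (hr : 0 < r) => ?_)
    simp only [fluxField, hnorm hr, NormedSpace.normalize_smul_of_pos hr,
      NormedSpace.normalize_eq_self_of_norm_eq_one hθ, inner_gradient_left,
      map_smul, smul_eq_mul]

theorem integral_shell_eq_neg_integral_inner_fluxField [NeZero N] (ha : 0 ≤ a)
    (hφ : ContDiff ℝ 1 φ) (hφc : HasCompactSupport φ) :
    ∫ x in shell N a b, φ x = -∫ x, ⟪∇ φ x, fluxField N a b x⟫ := by
  rw [← integral_indicator (measurableSet_shell a b),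
    integral_eq_integral_toSphere_integral_Ioi volume
      ((hφ.continuous.integrable_of_hasCompactSupport hφc).indicator (measurableSet_shell a b)),
    integral_eq_integral_toSphere_integral_Ioi volume (integrable_inner_fluxField ha
      (continuous_gradient_of_contDiff hφ) (hasCompactSupport_gradient hφc)),
    ← integral_neg]
  simp only [finrank_euclideanSpace_fin, smul_eq_mul]
  exact integral_congr_ae (.of_forall fun θ =>
    integral_ray_eq_neg_integral_ray_inner_fluxField ha hφ hφc (norm_eq_of_mem_sphere θ))

/-- A `1`-Lipschitz, continuously differentiable approximation of `|t|` that vanishes at `0`. -/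
noncomputable def smoothAbs (ε t : ℝ) : ℝ :=
  √(t ^ 2 + ε ^ 2) - ε

theorem abs_le_smoothAbs_add (ε t : ℝ) : |t| ≤ smoothAbs ε t + ε := by
  rw [smoothAbs, sub_add_cancel]
  exact Real.abs_le_sqrt (by linarith [sq_nonneg ε])

theorem smoothAbs_zero {ε : ℝ} (hε : 0 ≤ ε) : smoothAbs ε 0 = 0 := by
  simp [smoothAbs, Real.sqrt_sq hε]

theorem contDiff_smoothAbs {ε : ℝ} (hε : 0 < ε) : ContDiff ℝ 1 (smoothAbs ε) :=
  ((contDiff_id.pow 2 |>.add contDiff_const).sqrt fun t => by positivity).sub contDiff_const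

theorem abs_deriv_smoothAbs_le {ε : ℝ} (hε : 0 < ε) (t : ℝ) : |deriv (smoothAbs ε) t| ≤ 1 := by
  have hpos : 0 < t ^ 2 + ε ^ 2 := by positivity
  have hderiv : HasDerivAt (smoothAbs ε) (t / √(t ^ 2 + ε ^ 2)) t := by
    refine ((((hasDerivAt_pow 2 t).add_const (ε ^ 2)).sqrt hpos.ne').sub_const ε).congr_deriv ?_
    simp only [Nat.cast_ofNat, Nat.add_one_sub_one, pow_one]
    field
  rw [hderiv.deriv, abs_div, abs_of_pos (Real.sqrt_pos.2 hpos), div_le_one (Real.sqrt_pos.2 hpos)]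
  exact Real.abs_le_sqrt (by linarith [sq_nonneg ε])

theorem norm_gradient_comp_smoothAbs_le (hφ : ContDiff ℝ 1 φ) {ε : ℝ} (hε : 0 < ε)
    (x : EuclideanSpace ℝ (Fin N)) : ‖∇ (smoothAbs ε ∘ φ) x‖ ≤ ‖∇ φ x‖ := by
  have hchain := ((contDiff_smoothAbs hε).differentiable one_ne_zero (φ x)).hasDerivAt
    |>.comp_hasFDerivAt x (hφ.differentiable one_ne_zero x).hasFDerivAt
  rw [gradient, gradient, LinearIsometryEquiv.norm_map, LinearIsometryEquiv.norm_map,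
    hchain.fderiv, norm_smul]
  exact mul_le_of_le_one_left (norm_nonneg _) (abs_deriv_smoothAbs_le hε _)

theorem volume_shell_ne_top (a b : ℝ) : volume (shell N a b) ≠ ⊤ :=
  measure_ne_top_of_subset (fun _ hx => mem_ball_zero_iff.2 hx.2)
    (measure_ball_lt_top (x := 0) (r := b)).ne

theorem integral_shell_abs_le_integral_norm_gradient_mul [NeZero N] (ha : 0 ≤ a)
    (hφ : ContDiff ℝ 1 φ) (hφc : HasCompactSupport φ) :
    ∫ x in shell N a b, |φ x| ≤ ∫ x, ‖∇ φ x‖ * ‖fluxField N a b x‖ := by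
  set v := volume.real (shell N a b)
  have hgradc := hasCompactSupport_gradient hφc
  have hgrad := continuous_gradient_of_contDiff hφ
  have hint : ∀ {f : EuclideanSpace ℝ (Fin N) → ℝ}, Continuous f → HasCompactSupport f →
      IntegrableOn f (shell N a b) := fun hf hfc =>
    (hf.integrable_of_hasCompactSupport hfc).integrableOn
  have happrox : ∀ ε > 0, ∫ x in shell N a b, |φ x| ≤
      (∫ x, ‖∇ φ x‖ * ‖fluxField N a b x‖) + ε * v := fun ε hε => by
    have hψ : ContDiff ℝ 1 (smoothAbs ε ∘ φ) := (contDiff_smoothAbs hε).comp hφ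
    have hψc : HasCompactSupport (smoothAbs ε ∘ φ) := hφc.comp_left (smoothAbs_zero hε.le)
    have hconst : IntegrableOn (fun _ => ε) (shell N a b) :=
      integrableOn_const (volume_shell_ne_top a b)
    have hψint := hint hψ.continuous hψc
    calc ∫ x in shell N a b, |φ x| ≤ ∫ x in shell N a b, ((smoothAbs ε ∘ φ) x + ε) :=
          integral_mono (hint hφ.continuous hφc).abs (hψint.add hconst)
            fun x => abs_le_smoothAbs_add ε (φ x)
      _ = (-∫ x, ⟪∇ (smoothAbs ε ∘ φ) x, fluxField N a b x⟫) + ε * v := by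
          rw [integral_add hψint hconst, integral_shell_eq_neg_integral_inner_fluxField ha hψ hψc,
            setIntegral_const, smul_eq_mul, mul_comm v]
      _ ≤ (∫ x, ‖∇ φ x‖ * ‖fluxField N a b x‖) + ε * v := by
          rw [← integral_neg]
          gcongr with x
          · exact (integrable_inner_fluxField ha (continuous_gradient_of_contDiff hψ)
              (hasCompactSupport_gradient hψc)).neg
          · exact integrable_norm_mul_norm_fluxField ha hgrad hgradc
          · intro x
            refine (neg_le_abs _).trans ((abs_real_inner_le_norm _ _).trans ?_)
            exact mul_le_mul_of_nonneg_right (norm_gradient_comp_smoothAbs_le hφ hε x)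
              (norm_nonneg _)
  refine le_of_forall_pos_le_add fun ε hε => (happrox (ε / (v + 1)) (by positivity)).trans ?_
  have : ε / (v + 1) * v ≤ ε := by
    rw [div_mul_eq_mul_div, div_le_iff₀ (by positivity)]
    nlinarith [measureReal_nonneg (μ := volume) (s := shell N a b)]
  linarith

end Flux

section ConvergenceOfIntegrals

open Filter
open scoped Topology RealInnerProductSpace

variable {α E F : Type*} [MeasurableSpace α] {μ : Measure α} [NormedAddCommGroup E]
  [NormedAddCommGroup F] [InnerProductSpace ℝ F] {C : ℝ}

theorem tendsto_integral_inner_of_tendsto_eLpNorm_one {f : ℕ → α → F} {g X : α → F}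
    (hf : ∀ k, Integrable (f k) μ) (hg : AEStronglyMeasurable g μ)
    (hX : AEStronglyMeasurable X μ) (hXC : ∀ᵐ x ∂μ, ‖X x‖ ≤ C)
    (hlim : Tendsto (fun k => eLpNorm (f k - g) 1 μ) atTop (𝓝 0)) :
    Tendsto (fun k => ∫ x, ⟪f k x, X x⟫ ∂μ) atTop (𝓝 (∫ x, ⟪g x, X x⟫ ∂μ)) := by
  have hinner : ∀ h : α → F, ∀ᵐ x ∂μ, ‖⟪h x, X x⟫‖ ≤ C * ‖h x‖ := fun h => by
    filter_upwards [hXC] with x hx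
    rw [mul_comm]
    exact (norm_inner_le_norm _ _).trans (by gcongr)
  refine tendsto_integral_of_L1' _ (hg.inner hX) (.of_forall fun k =>
    ((hf k).norm.const_mul C).mono' ((hf k).1.inner hX) (hinner (f k))) ?_
  have hbound : Tendsto (fun k => ENNReal.ofReal C * eLpNorm (f k - g) 1 μ) atTop (𝓝 0) := by
    simpa using ENNReal.Tendsto.const_mul hlim (Or.inr ENNReal.ofReal_ne_top)
  refine tendsto_of_tendsto_of_tendsto_of_le_of_le tendsto_const_nhds hbound
    (fun _ => zero_le) fun k => eLpNorm_le_mul_eLpNorm_of_ae_le_mul ?_ 1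
  filter_upwards [hinner (f k - g)] with x hx
  simpa only [Pi.sub_apply, inner_sub_left] using hx

section Bounded

variable {f : ℕ → α → E} {g : α → E} (hf : ∀ k, AEStronglyMeasurable (f k) μ)
  (hfC : ∀ k, ∀ᵐ x ∂μ, ‖f k x‖ ≤ C) (hlim : ∀ᵐ x ∂μ, Tendsto (fun k => f k x) atTop (𝓝 (g x)))

include hfC hlim in
theorem ae_norm_le_of_bounded_tendsto : ∀ᵐ x ∂μ, ‖g x‖ ≤ C := by
  filter_upwards [ae_all_iff.2 hfC, hlim] with x hx hxlim using le_of_tendsto' hxlim.norm hx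

include hf hfC hlim

theorem memLp_of_bounded_tendsto [IsFiniteMeasure μ] (q : ℝ≥0∞) : MemLp g q μ :=
  .of_bound (aestronglyMeasurable_of_tendsto_ae atTop hf hlim) C
    (ae_norm_le_of_bounded_tendsto hfC hlim)

theorem tendsto_integral_bilin_of_bounded {F G : Type*} [NormedAddCommGroup F]
    [NormedAddCommGroup G] [NormedSpace ℝ E] [NormedSpace ℝ F] [NormedSpace ℝ G]
    (B : E →L[ℝ] F →L[ℝ] G) {w : α → F} (hw : Integrable w μ) :
    Tendsto (fun k => ∫ x, B (f k x) (w x) ∂μ) atTop (𝓝 (∫ x, B (g x) (w x) ∂μ)) := by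
  refine tendsto_integral_of_dominated_convergence (fun x => ‖B‖ * C * ‖w x‖)
    (fun k => B.aestronglyMeasurable_comp₂ (hf k) hw.1) (hw.norm.const_mul _) (fun k => ?_) ?_
  · filter_upwards [hfC k] with x hx
    exact (B.le_opNorm₂ _ _).trans (by gcongr)
  · filter_upwards [hlim] with x hx using ((B.flip (w x)).continuous.tendsto _).comp hx

theorem tendsto_eLpNorm_sub_of_bounded [IsFiniteMeasure μ] {p : ℝ} (hp : 0 < p) :
    Tendsto (fun k => eLpNorm (fun x => g x - f k x) (ENNReal.ofReal p) μ) atTop (𝓝 0) := by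
  have hg := aestronglyMeasurable_of_tendsto_ae atTop hf hlim
  have hpow : ∀ {q : ℝ}, 0 < q → Tendsto (fun t : ℝ≥0∞ => t ^ q) (𝓝 0) (𝓝 0) := fun {q} hq => by
    simpa only [ENNReal.zero_rpow_of_pos hq] using
      (ENNReal.continuous_rpow_const (y := q)).tendsto 0
  have hintegral : Tendsto (fun k => ∫⁻ x, ‖g x - f k x‖ₑ ^ p ∂μ) atTop (𝓝 0) := by
    rw [← lintegral_zero (μ := μ)]
    refine tendsto_lintegral_of_dominated_convergence' (fun _ => ENNReal.ofReal (C + C) ^ p)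
      (fun k => (hg.sub (hf k)).enorm.pow_const p) (fun k => ?_) ?_ ?_
    · filter_upwards [hfC k, ae_norm_le_of_bounded_tendsto hfC hlim] with x hx hgx
      gcongr
      rw [← ofReal_norm]
      exact ENNReal.ofReal_le_ofReal ((norm_sub_le _ _).trans (add_le_add hgx hx))
    · rw [lintegral_const]
      exact ENNReal.mul_ne_top (ENNReal.rpow_ne_top_of_nonneg hp.le ENNReal.ofReal_ne_top)
        (measure_ne_top _ _)
    · filter_upwards [hlim] with x hx
      refine (hpow hp).comp ?_
      simpa using (hx.const_sub (g x)).enorm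
  refine ((hpow (one_div_pos.2 hp)).comp hintegral).congr fun k => ?_
  rw [eLpNorm_eq_lintegral_rpow_enorm_toReal (by simpa using hp) ENNReal.ofReal_ne_top,
    ENNReal.toReal_ofReal hp.le]
  rfl

end Bounded

end ConvergenceOfIntegrals

section SobolevZero

open Filter
open scoped Topology RealInnerProductSpace

variable {N : ℕ} {Ω : Set (EuclideanSpace ℝ (Fin N))} {φ ψ u u' : EuclideanSpace ℝ (Fin N) → ℝ}
  {G G' : EuclideanSpace ℝ (Fin N) → EuclideanSpace ℝ (Fin N)} {p : ℝ}

theorem IsTestFunction.eq_zero (hφ : IsTestFunction Ω φ) {x : EuclideanSpace ℝ (Fin N)}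
    (hx : x ∉ Ω) : φ x = 0 :=
  image_eq_zero_of_notMem_tsupport fun h => hx (hφ.2.2 h)

theorem gradient_eq_zero_of_notMem_tsupport {x : EuclideanSpace ℝ (Fin N)}
    (hx : x ∉ tsupport φ) : ∇ φ x = 0 := by
  rw [gradient, image_eq_zero_of_notMem_tsupport fun h => hx (tsupport_fderiv_subset ℝ h), map_zero]

theorem IsTestFunction.gradient_eq_zero (hφ : IsTestFunction Ω φ)
    {x : EuclideanSpace ℝ (Fin N)} (hx : x ∉ Ω) : ∇ φ x = 0 :=
  gradient_eq_zero_of_notMem_tsupport fun h => hx (hφ.2.2 h)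

theorem IsTestFunction.contDiff_one (hφ : IsTestFunction Ω φ) : ContDiff ℝ 1 φ :=
  hφ.1.of_le (by simp)

theorem IsTestFunction.memLp (hφ : IsTestFunction Ω φ) (q : ℝ≥0∞)
    (s : Set (EuclideanSpace ℝ (Fin N))) : MemLp φ q (volume.restrict s) :=
  hφ.1.continuous.memLp_of_hasCompactSupport hφ.2.1

theorem IsTestFunction.memLp_gradient (hφ : IsTestFunction Ω φ) (q : ℝ≥0∞)
    (s : Set (EuclideanSpace ℝ (Fin N))) : MemLp (∇ φ) q (volume.restrict s) :=
  (continuous_gradient_of_contDiff hφ.contDiff_one).memLp_of_hasCompactSupport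
    (hasCompactSupport_gradient hφ.2.1)

theorem IsTestFunction.integrableOn_gradient (hφ : IsTestFunction Ω φ)
    (s : Set (EuclideanSpace ℝ (Fin N))) : IntegrableOn (∇ φ) s :=
  memLp_one_iff_integrable.1 (hφ.memLp_gradient 1 s)

theorem IsTestFunction.sub (hφ : IsTestFunction Ω φ) (hψ : IsTestFunction Ω ψ) :
    IsTestFunction Ω (φ - ψ) :=
  ⟨hφ.1.sub hψ.1, hφ.2.1.sub hψ.2.1, (tsupport_sub φ ψ).trans (union_subset hφ.2.2 hψ.2.2)⟩

theorem IsTestFunction.gradient_sub (hφ : IsTestFunction Ω φ) (hψ : IsTestFunction Ω ψ) :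
    ∇ (φ - ψ) = ∇ φ - ∇ ψ := by
  ext1 x
  simp only [Pi.sub_apply, gradient]
  rw [fderiv_sub (hφ.1.differentiable (by simp) x) (hψ.1.differentiable (by simp) x), map_sub]

theorem IsTestFunction.integral_smul_gradient (hφ : IsTestFunction Ω φ)
    (hψ : IsTestFunction Ω ψ) : ∫ x in Ω, φ x • ∇ ψ x = -∫ x in Ω, ψ x • ∇ φ x := by
  have hint : ∀ {f g : EuclideanSpace ℝ (Fin N) → ℝ}, IsTestFunction Ω f → IsTestFunction Ω g →
      Integrable fun x => f x • ∇ g x := fun hf hg =>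
    (hf.1.continuous.smul (continuous_gradient_of_contDiff hg.contDiff_one))
      |>.integrable_of_hasCompactSupport hf.2.1.smul_right
  have hzero : ∀ {f g : EuclideanSpace ℝ (Fin N) → ℝ}, IsTestFunction Ω f →
      ∀ x, x ∉ Ω → f x • ∇ g x = 0 := fun hf x hx => by rw [hf.eq_zero hx, zero_smul]
  rw [setIntegral_eq_integral_of_forall_compl_eq_zero (hzero hφ),
    setIntegral_eq_integral_of_forall_compl_eq_zero (hzero hψ)]
  refine ext_inner_left ℝ fun v => ?_
  rw [inner_neg_right, ← integral_inner (hint hφ hψ), ← integral_inner (hint hψ hφ)]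
  have hfd : ∀ {f g : EuclideanSpace ℝ (Fin N) → ℝ}, IsTestFunction Ω f → IsTestFunction Ω g →
      Integrable fun x => f x * fderiv ℝ g x v := fun hf hg => by
    simpa only [real_inner_smul_right, inner_gradient_right, conj_trivial] using
      (hint hf hg).const_inner (𝕜 := ℝ) v
  have hparts := integral_mul_fderiv_eq_neg_fderiv_mul_of_integrable (μ := volume) (v := v)
    (f := φ) (g := ψ) (by simpa only [mul_comm] using hfd hψ hφ) (hfd hφ hψ)
    ((hφ.1.continuous.mul hψ.1.continuous).integrable_of_hasCompactSupport hφ.2.1.mul_right)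
    (fun x _ => hφ.1.differentiable (by simp) x) (fun x _ => hψ.1.differentiable (by simp) x)
  simpa only [real_inner_smul_right, inner_gradient_right, conj_trivial, mul_comm] using hparts

theorem IsTestFunction.memSobolevZero (hφ : IsTestFunction Ω φ) :
    MemSobolevZero p Ω φ (∇ φ) :=
  ⟨⟨hφ.memLp _ _, hφ.memLp_gradient _ _,
    hφ.1.continuous.locallyIntegrable.locallyIntegrableOn Ω,
    (continuous_gradient_of_contDiff hφ.contDiff_one).locallyIntegrable.locallyIntegrableOn Ω,
    fun _ hψ => hφ.integral_smul_gradient hψ⟩, fun _ hε => ⟨φ, hφ, by simpa using hε⟩⟩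

theorem IsTestFunction.integrable_smul_gradient (hφ : IsTestFunction Ω φ)
    (hu : LocallyIntegrableOn u Ω) : Integrable fun x => u x • ∇ φ x :=
  ((hu.integrableOn_compact_subset hφ.2.2 hφ.2.1).smul_continuousOn
    (continuous_gradient_of_contDiff hφ.contDiff_one).continuousOn hφ.2.1)
      |>.integrable_of_forall_notMem_eq_zero fun x hx => by
        rw [gradient_eq_zero_of_notMem_tsupport hx, smul_zero]

theorem IsTestFunction.integrable_smul (hφ : IsTestFunction Ω φ)
    (hG : LocallyIntegrableOn G Ω) : Integrable fun x => φ x • G x :=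
  ((hG.integrableOn_compact_subset hφ.2.2 hφ.2.1).continuousOn_smul
    hφ.1.continuous.continuousOn hφ.2.1).integrable_of_forall_notMem_eq_zero fun x hx => by
      rw [image_eq_zero_of_notMem_tsupport hx, zero_smul]

theorem IsWeakGradient.sub (h : IsWeakGradient Ω u G) (h' : IsWeakGradient Ω u' G') :
    IsWeakGradient Ω (u - u') (G - G') := by
  refine ⟨h.1.sub h'.1, h.2.1.sub h'.2.1, fun φ hφ => ?_⟩
  simp only [Pi.sub_apply, sub_smul, smul_sub]
  rw [integral_sub (hφ.integrable_smul_gradient h.1).integrableOn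
      (hφ.integrable_smul_gradient h'.1).integrableOn,
    integral_sub (hφ.integrable_smul h.2.1).integrableOn (hφ.integrable_smul h'.2.1).integrableOn,
    h.2.2 φ hφ, h'.2.2 φ hφ]
  abel

theorem MemSobolevZero.sub (hp : 1 ≤ p) (h : MemSobolevZero p Ω u G)
    (h' : MemSobolevZero p Ω u' G') : MemSobolevZero p Ω (u - u') (G - G') := by
  have hp' : 1 ≤ ENNReal.ofReal p := by simpa using hp
  obtain ⟨⟨hu, hG, hweak⟩, hdense⟩ := h
  obtain ⟨⟨hu', hG', hweak'⟩, hdense'⟩ := h'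
  refine ⟨⟨hu.sub hu', hG.sub hG', hweak.sub hweak'⟩, fun ε hε => ?_⟩
  obtain ⟨φ, hφ, hφε⟩ := hdense (ε / 2) (ENNReal.half_pos hε.ne')
  obtain ⟨ψ, hψ, hψε⟩ := hdense' (ε / 2) (ENNReal.half_pos hε.ne')
  have hfun : (fun x => (u - u') x - (φ - ψ) x) = (u - φ) - (u' - ψ) := by
    ext x; simp only [Pi.sub_apply]; ring
  have hgrad : (fun x => (G - G') x - ∇ (φ - ψ) x) = (G - ∇ φ) - (G' - ∇ ψ) := by
    ext1 x; simp only [hφ.gradient_sub hψ, Pi.sub_apply]; abel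
  refine ⟨φ - ψ, hφ.sub hψ, ?_⟩
  rw [hfun, hgrad]
  calc _ ≤ (eLpNorm (u - φ) (ENNReal.ofReal p) (volume.restrict Ω) +
          eLpNorm (u' - ψ) (ENNReal.ofReal p) (volume.restrict Ω)) +
        (eLpNorm (G - ∇ φ) (ENNReal.ofReal p) (volume.restrict Ω) +
          eLpNorm (G' - ∇ ψ) (ENNReal.ofReal p) (volume.restrict Ω)) :=
        add_le_add
          (eLpNorm_sub_le (hu.sub (hφ.memLp _ _)).1 (hu'.sub (hψ.memLp _ _)).1 hp')
          (eLpNorm_sub_le (hG.sub (hφ.memLp_gradient _ _)).1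
            (hG'.sub (hψ.memLp_gradient _ _)).1 hp')
    _ < ε / 2 + ε / 2 := by
        rw [add_add_add_comm]
        exact ENNReal.add_lt_add hφε hψε
    _ = ε := ENNReal.add_halves ε

theorem MemSobolevZero.exists_seq [IsFiniteMeasure (volume.restrict Ω)] (hp : 1 ≤ p)
    (h : MemSobolevZero p Ω u G) :
    ∃ φ : ℕ → EuclideanSpace ℝ (Fin N) → ℝ, (∀ k, IsTestFunction Ω (φ k)) ∧
      Tendsto (fun k => eLpNorm (φ k - u) 1 (volume.restrict Ω)) atTop (𝓝 0) ∧
      Tendsto (fun k => eLpNorm (∇ (φ k) - G) 1 (volume.restrict Ω)) atTop (𝓝 0) := by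
  have hp' : 1 ≤ ENNReal.ofReal p := by simpa using hp
  set μ := volume.restrict Ω
  set C := μ univ ^ (1 / (1 : ℝ≥0∞).toReal - 1 / (ENNReal.ofReal p).toReal)
  have hC : C ≠ ⊤ := by
    refine ENNReal.rpow_ne_top_of_nonneg ?_ (measure_ne_top _ _)
    rw [ENNReal.toReal_ofReal (by linarith), ENNReal.toReal_one, one_div_one, sub_nonneg]
    exact div_le_one_of_le₀ hp (by linarith)
  choose φ hφ hφε using fun k : ℕ => h.2 (k + 1 : ℝ≥0∞)⁻¹
    (ENNReal.inv_pos.2 (ENNReal.add_ne_top.2 ⟨ENNReal.natCast_ne_top k, ENNReal.one_ne_top⟩))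
  have hlim : Tendsto (fun k : ℕ => (k + 1 : ℝ≥0∞)⁻¹ * C) atTop (𝓝 0) := by
    have hinv : Tendsto (fun k : ℕ => (k + 1 : ℝ≥0∞)⁻¹) atTop (𝓝 0) := by
      simpa using (tendsto_add_atTop_iff_nat 1).2 ENNReal.tendsto_inv_nat_nhds_zero
    simpa using ENNReal.Tendsto.mul_const hinv (Or.inr hC)
  refine ⟨φ, hφ, tendsto_of_tendsto_of_tendsto_of_le_of_le tendsto_const_nhds hlim
    (fun _ => zero_le) fun k => ?_, tendsto_of_tendsto_of_tendsto_of_le_of_le tendsto_const_nhds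
    hlim (fun _ => zero_le) fun k => ?_⟩
  · rw [eLpNorm_sub_comm]
    refine (eLpNorm_le_eLpNorm_mul_rpow_measure_univ hp' (h.1.1.sub ((hφ k).memLp _ _)).1).trans ?_
    gcongr
    exact le_self_add.trans (hφε k).le
  · rw [eLpNorm_sub_comm]
    refine (eLpNorm_le_eLpNorm_mul_rpow_measure_univ hp'
      (h.1.2.1.sub ((hφ k).memLp_gradient _ _)).1).trans ?_
    gcongr
    exact le_add_self.trans (hφε k).le

section BoundedLimit

variable [IsFiniteMeasure (volume.restrict Ω)] {C D : ℝ} {φ : ℕ → EuclideanSpace ℝ (Fin N) → ℝ}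
  (hφ : ∀ k, IsTestFunction Ω (φ k)) (hφC : ∀ k, ∀ᵐ x ∂volume.restrict Ω, ‖φ k x‖ ≤ C)
  (hφD : ∀ k, ∀ᵐ x ∂volume.restrict Ω, ‖∇ (φ k) x‖ ≤ D)
  (hu : ∀ᵐ x ∂volume.restrict Ω, Tendsto (fun k => φ k x) atTop (𝓝 (u x)))
  (hG : ∀ᵐ x ∂volume.restrict Ω, Tendsto (fun k => ∇ (φ k) x) atTop (𝓝 (G x)))

include hφ hφC hφD hu hG

theorem isWeakGradient_of_bounded_tendsto : IsWeakGradient Ω u G := by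
  have hφm : ∀ k, AEStronglyMeasurable (φ k) (volume.restrict Ω) := fun k => ((hφ k).memLp 1 _).1
  have hDm : ∀ k, AEStronglyMeasurable (∇ (φ k)) (volume.restrict Ω) := fun k =>
    ((hφ k).memLp_gradient 1 _).1
  refine ⟨IntegrableOn.locallyIntegrableOn (memLp_one_iff_integrable.1
    (memLp_of_bounded_tendsto hφm hφC hu 1)), IntegrableOn.locallyIntegrableOn
    (memLp_one_iff_integrable.1 (memLp_of_bounded_tendsto hDm hφD hG 1)), fun ψ hψ => ?_⟩
  refine tendsto_nhds_unique (tendsto_integral_bilin_of_bounded hφm hφC hu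
    (ContinuousLinearMap.lsmul ℝ ℝ) (hψ.integrableOn_gradient Ω)) ?_
  refine (tendsto_integral_bilin_of_bounded hDm hφD hG (ContinuousLinearMap.lsmul ℝ ℝ).flip
    (memLp_one_iff_integrable.1 (hψ.memLp 1 Ω))).neg.congr fun k => ?_
  exact ((hφ k).integral_smul_gradient hψ).symm

theorem memSobolevZero_of_bounded_tendsto (hp : 0 < p) : MemSobolevZero p Ω u G := by
  have hφm : ∀ k, AEStronglyMeasurable (φ k) (volume.restrict Ω) := fun k => ((hφ k).memLp 1 _).1
  have hDm : ∀ k, AEStronglyMeasurable (∇ (φ k)) (volume.restrict Ω) := fun k =>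
    ((hφ k).memLp_gradient 1 _).1
  refine ⟨⟨memLp_of_bounded_tendsto hφm hφC hu _, memLp_of_bounded_tendsto hDm hφD hG _,
    isWeakGradient_of_bounded_tendsto hφ hφC hφD hu hG⟩, fun ε hε => ?_⟩
  have hlim := (tendsto_eLpNorm_sub_of_bounded hφm hφC hu hp).add
    (tendsto_eLpNorm_sub_of_bounded hDm hφD hG hp)
  rw [add_zero] at hlim
  obtain ⟨k, hk⟩ := (hlim.eventually (gt_mem_nhds hε)).exists
  exact ⟨φ k, hφ k, hk⟩

end BoundedLimit

section FluxIdentity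

variable {a b R : ℝ}

theorem shell_subset_ball (hbR : b ≤ R) : shell N a b ⊆ ball 0 R := fun _ hx =>
  mem_ball_zero_iff.2 (hx.2.trans_le hbR)

instance isFiniteMeasure_restrict_ball {x : EuclideanSpace ℝ (Fin N)} :
    IsFiniteMeasure (volume.restrict (ball x R)) :=
  ⟨by simpa using measure_ball_lt_top⟩

variable [NeZero N] (ha : 0 ≤ a)

include ha

theorem ae_norm_fluxField_le : ∀ᵐ x ∂volume.restrict (ball 0 R), ‖fluxField N a b x‖ ≤ R := by
  filter_upwards [ae_restrict_mem measurableSet_ball] with x hx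
  exact (norm_fluxField_le ha x).trans (mem_ball_zero_iff.1 hx).le

theorem IsTestFunction.integral_shell_eq (hφ : IsTestFunction (ball 0 R) φ) :
    ∫ x in shell N a b, φ x = -∫ x in ball 0 R, ⟪∇ φ x, fluxField N a b x⟫ := by
  rw [setIntegral_eq_integral_of_forall_compl_eq_zero (s := ball 0 R) fun x hx => by
    rw [hφ.gradient_eq_zero hx, inner_zero_left]]
  exact integral_shell_eq_neg_integral_inner_fluxField ha hφ.contDiff_one hφ.2.1

theorem IsTestFunction.integral_shell_abs_le (hφ : IsTestFunction (ball 0 R) φ) :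
    ∫ x in shell N a b, |φ x| ≤ ∫ x in ball 0 R, ‖∇ φ x‖ * ‖fluxField N a b x‖ := by
  rw [setIntegral_eq_integral_of_forall_compl_eq_zero (s := ball 0 R) fun x hx => by
    rw [hφ.gradient_eq_zero hx, norm_zero, zero_mul]]
  exact integral_shell_abs_le_integral_norm_gradient_mul ha hφ.contDiff_one hφ.2.1

variable (hbR : b ≤ R) (hp : 1 ≤ p) (h : MemSobolevZero p (ball 0 R) u G)

include hbR hp h

theorem MemSobolevZero.integral_shell_eq :
    ∫ x in shell N a b, u x = -∫ x in ball 0 R, ⟪G x, fluxField N a b x⟫ := by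
  obtain ⟨φ, hφ, hφu, hφG⟩ := h.exists_seq hp
  have hleft := tendsto_setIntegral_of_L1' u h.1.1.1
    (.of_forall fun k => memLp_one_iff_integrable.1 ((hφ k).memLp 1 _)) hφu (shell N a b)
  rw [Measure.restrict_restrict_of_subset (shell_subset_ball hbR)] at hleft
  have hright := tendsto_integral_inner_of_tendsto_eLpNorm_one
    (fun k => (hφ k).integrableOn_gradient _) h.1.2.1.1
    measurable_fluxField.aestronglyMeasurable (ae_norm_fluxField_le (b := b) ha) hφG
  refine tendsto_nhds_unique hleft (hright.neg.congr fun k => ?_)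
  exact ((hφ k).integral_shell_eq ha).symm

theorem MemSobolevZero.integral_shell_abs_le :
    ∫ x in shell N a b, |u x| ≤ ∫ x in ball 0 R, ‖G x‖ * ‖fluxField N a b x‖ := by
  obtain ⟨φ, hφ, hφu, hφG⟩ := h.exists_seq hp
  have habs : Tendsto (fun k => eLpNorm (fun x => |φ k x| - |u x|) 1 (volume.restrict (ball 0 R)))
      atTop (𝓝 0) := tendsto_of_tendsto_of_tendsto_of_le_of_le tendsto_const_nhds hφu
    (fun _ => zero_le) fun k => eLpNorm_mono fun x => abs_abs_sub_abs_le (φ k x) (u x)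
  have hnorm : Tendsto (fun k => eLpNorm (fun x => ‖∇ (φ k) x‖ - ‖G x‖) 1
      (volume.restrict (ball 0 R))) atTop (𝓝 0) :=
    tendsto_of_tendsto_of_tendsto_of_le_of_le tendsto_const_nhds hφG
    (fun _ => zero_le) fun k => eLpNorm_mono fun x => abs_norm_sub_norm_le (∇ (φ k) x) (G x)
  have hleft := tendsto_setIntegral_of_L1' (fun x => |u x|) h.1.1.1.norm
    (.of_forall fun k => (memLp_one_iff_integrable.1 ((hφ k).memLp 1 _)).abs) habs (shell N a b)
  rw [Measure.restrict_restrict_of_subset (shell_subset_ball hbR)] at hleft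
  have hright := tendsto_integral_inner_of_tendsto_eLpNorm_one (X := fun x => ‖fluxField N a b x‖)
    (fun k => ((hφ k).integrableOn_gradient _).norm) h.1.2.1.1.norm
    measurable_fluxField.norm.aestronglyMeasurable
    (by simpa only [norm_norm] using ae_norm_fluxField_le (b := b) ha) hnorm
  simp only [RCLike.inner_apply, conj_trivial, mul_comm ‖fluxField N a b _‖] at hright
  exact le_of_tendsto_of_tendsto' hleft hright fun k => (hφ k).integral_shell_abs_le ha

end FluxIdentity

end SobolevZero

section RadialFunctions

open Filter
open scoped Topology NNReal

section Approximation

variable {a R r : ℝ}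

/-- A continuous cutoff with values in `[0, 1]`, supported in `[a + 1/(k+1), R - 1/(k+1)]`; as
`k → ∞` it increases to the indicator function of `(a, R)`. -/
noncomputable def intervalCutoff (a R : ℝ) (k : ℕ) (r : ℝ) : ℝ :=
  max 0 (min 1 ((k + 1) * min (r - a) (R - r) - 1))

theorem intervalCutoff_mem_Icc (k : ℕ) (r : ℝ) : intervalCutoff a R k r ∈ Icc 0 1 :=
  ⟨le_max_left _ _, max_le zero_le_one (min_le_left _ _)⟩

theorem support_intervalCutoff_subset (k : ℕ) :
    Function.support (intervalCutoff a R k) ⊆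
      Icc (a + 1 / ((k : ℝ) + 1)) (R - 1 / ((k : ℝ) + 1)) := fun r hr => by
  have hpos : 0 < intervalCutoff a R k r := (intervalCutoff_mem_Icc k r).1.lt_of_ne' hr
  simp only [intervalCutoff, lt_max_iff, lt_irrefl, false_or, lt_min_iff] at hpos
  have hlt : 1 / ((k : ℝ) + 1) < min (r - a) (R - r) := by
    rw [div_lt_iff₀ (by positivity)]
    linarith [hpos.2]
  constructor <;> linarith [lt_min_iff.1 hlt]

theorem tendsto_intervalCutoff (hr : r ∈ Ioo a R) :
    Tendsto (fun k => intervalCutoff a R k r) atTop (𝓝 1) := by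
  have hlim : Tendsto (fun k : ℕ => ((k : ℝ) + 1) * min (r - a) (R - r) - 1) atTop atTop :=
    tendsto_atTop_add_const_right _ _ ((tendsto_atTop_add_const_right _ 1
      tendsto_natCast_atTop_atTop).atTop_mul_const (lt_min (sub_pos.2 hr.1) (sub_pos.2 hr.2)))
  refine tendsto_const_nhds.congr' ?_
  filter_upwards [hlim.eventually_ge_atTop 1] with k hk
  rw [intervalCutoff, min_eq_left hk, max_eq_right zero_le_one]

variable {h : ℝ → ℝ} {C : ℝ}

theorem continuous_intervalCutoff_mul (hh : ContinuousOn h (Ioo a R)) (k : ℕ) :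
    Continuous fun r => intervalCutoff a R k r * h r := by
  have hcut : Continuous (intervalCutoff a R k) := by unfold intervalCutoff; fun_prop
  refine (hcut.continuousOn.mul hh).continuous_of_tsupport_subset isOpen_Ioo ?_
  have hk : (0 : ℝ) < 1 / ((k : ℝ) + 1) := Nat.one_div_pos_of_nat
  exact (closure_minimal ((Function.support_mul_subset_left _ _).trans
    (support_intervalCutoff_subset k)) isClosed_Icc).trans
    (Icc_subset_Ioo (by linarith) (by linarith))

theorem exists_contDiff_bounded_tendsto (hh : ContinuousOn h (Ioo a R)) (hzero : ∀ r ≤ a, h r = 0)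
    (hC : ∀ r < R, |h r| ≤ C) :
    ∃ f : ℕ → ℝ → ℝ, (∀ k, ContDiff ℝ ∞ (f k)) ∧
      (∀ k, ∃ c d, a < c ∧ d < R ∧ Function.support (f k) ⊆ Icc c d) ∧
      (∀ k r, |f k r| ≤ C + 1) ∧ ∀ r < R, Tendsto (fun k => f k r) atTop (𝓝 (h r)) := by
  have hexists := fun k : ℕ =>
    (continuous_intervalCutoff_mul hh k).exists_contDiff_approx (⊤ : ℕ∞) continuous_const
      (fun _ => Nat.one_div_pos_of_nat (n := k))
  choose f hf hdist hsupp using hexists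
  have hcut : ∀ k, Function.support (f k) ⊆ Icc (a + 1 / ((k : ℝ) + 1)) (R - 1 / ((k : ℝ) + 1)) :=
    fun k => (hsupp k).trans ((Function.support_mul_subset_left _ _).trans
      (support_intervalCutoff_subset k))
  refine ⟨f, hf, fun k => ⟨_, _, lt_add_of_pos_right _ Nat.one_div_pos_of_nat,
    sub_lt_self _ Nat.one_div_pos_of_nat, hcut k⟩, fun k r => ?_, fun r hr => ?_⟩
  · have hbound : |intervalCutoff a R k r * h r| ≤ C := by
      obtain hr | hr := lt_or_ge r R
      · rw [abs_mul, abs_of_nonneg (intervalCutoff_mem_Icc k r).1]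
        exact (mul_le_of_le_one_left (abs_nonneg _) (intervalCutoff_mem_Icc k r).2).trans (hC r hr)
      · have : intervalCutoff a R k r = 0 := Function.notMem_support.1 fun hmem => by
          linarith [(support_intervalCutoff_subset k hmem).2,
            Nat.one_div_pos_of_nat (α := ℝ) (n := k)]
        simpa [this] using (abs_nonneg _).trans (hC (R - 1) (by linarith))
    have hclose : |f k r - intervalCutoff a R k r * h r| ≤ 1 :=
      (hdist k r).le.trans (div_le_one_of_le₀ (by simp) (by positivity))
    linarith [abs_sub_abs_le_abs_sub (f k r) (intervalCutoff a R k r * h r)]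
  · have hmul : Tendsto (fun k => intervalCutoff a R k r * h r) atTop (𝓝 (h r)) := by
      obtain hra | hra := le_or_gt r a
      · simp [hzero r hra]
      · simpa using (tendsto_intervalCutoff ⟨hra, hr⟩).mul_const (h r)
    refine tendsto_of_tendsto_of_dist hmul (squeeze_zero (fun _ => dist_nonneg) (fun k => ?_)
      tendsto_one_div_add_atTop_nhds_zero_nat)
    rw [dist_comm]
    exact (hdist k r).le

end Approximation

variable {N : ℕ} {g h : ℝ → ℝ} {c d p r R : ℝ} {x : EuclideanSpace ℝ (Fin N)}

/-- The radial function vanishing on `∂B_R` whose derivative in the outward direction is `-g`. -/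
noncomputable def radialPrimitive (g : ℝ → ℝ) (R : ℝ) (x : EuclideanSpace ℝ (Fin N)) : ℝ :=
  ∫ s in ‖x‖..R, g s

/-- The gradient of `radialPrimitive g R`. -/
noncomputable def radialGradient (g : ℝ → ℝ) (x : EuclideanSpace ℝ (Fin N)) :
    EuclideanSpace ℝ (Fin N) :=
  -g ‖x‖ • NormedSpace.normalize x

theorem norm_radialGradient (hg0 : g 0 = 0) (x : EuclideanSpace ℝ (Fin N)) :
    ‖radialGradient g x‖ = |g ‖x‖| := by
  obtain rfl | hx := eq_or_ne x 0
  · simp [radialGradient, hg0]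
  · rw [radialGradient, norm_smul, NormedSpace.norm_normalize hx, mul_one, norm_neg,
      Real.norm_eq_abs]

theorem norm_radialGradient_le (x : EuclideanSpace ℝ (Fin N)) :
    ‖radialGradient g x‖ ≤ |g ‖x‖| := by
  obtain rfl | hx := eq_or_ne x 0
  · simp [radialGradient]
  · rw [radialGradient, norm_smul, NormedSpace.norm_normalize hx, mul_one, norm_neg,
      Real.norm_eq_abs]

theorem hasGradientAt_norm (hx : x ≠ 0) :
    HasGradientAt (fun y : EuclideanSpace ℝ (Fin N) => ‖y‖) (NormedSpace.normalize x) x := by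
  have hsqrt := (hasStrictFDerivAt_norm_sq x).hasFDerivAt.sqrt (by positivity)
  simp only [Real.sqrt_sq (norm_nonneg _)] at hsqrt
  refine hasGradientAt_iff_hasFDerivAt.2 (hsqrt.congr_fderiv ?_)
  ext v
  simp only [one_div, mul_inv_rev, smul_apply, coe_innerSL_apply, nsmul_eq_mul, Nat.cast_ofNat,
    smul_eq_mul, NormedSpace.normalize, map_smul, InnerProductSpace.toDual_apply_apply]
  field_simp

theorem hasDerivAt_integral_left (hg : Continuous g) (r : ℝ) :
    HasDerivAt (fun t => ∫ s in t..R, g s) (-g r) r :=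
  intervalIntegral.integral_hasDerivAt_left (hg.intervalIntegrable _ _)
    (hg.stronglyMeasurableAtFilter _ _) hg.continuousAt

theorem contDiff_integral_left (hg : ContDiff ℝ ∞ g) : ContDiff ℝ ∞ fun t => ∫ s in t..R, g s := by
  have hderiv : (deriv fun t => ∫ s in t..R, g s) = fun r => -g r :=
    funext fun r => (hasDerivAt_integral_left hg.continuous r).deriv
  rw [contDiff_infty_iff_deriv, hderiv]
  exact ⟨fun r => (hasDerivAt_integral_left hg.continuous r).differentiableAt, hg.neg⟩

theorem hasGradientAt_radialPrimitive (hg : Continuous g) (hx : x ≠ 0) :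
    HasGradientAt (radialPrimitive g R) (radialGradient g x) x := by
  refine hasGradientAt_iff_hasFDerivAt.2 (((hasDerivAt_integral_left hg ‖x‖).comp_hasFDerivAt x
    (hasGradientAt_iff_hasFDerivAt.1 (hasGradientAt_norm hx))).congr_fderiv ?_)
  rw [radialGradient, map_smul]

theorem radialPrimitive_eq_of_norm_le (hg : Continuous g) (hgc : ∀ s < c, g s = 0)
    (hx : ‖x‖ ≤ c) : radialPrimitive g R x = ∫ s in c..R, g s := by
  rw [radialPrimitive, ← intervalIntegral.integral_add_adjacent_intervals
    (hg.intervalIntegrable ‖x‖ c) (hg.intervalIntegrable c R), add_eq_right,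
    intervalIntegral.integral_of_le hx, integral_Ioc_eq_integral_Ioo]
  exact setIntegral_eq_zero_of_forall_eq_zero fun s hs => hgc s hs.2

section CompactSupport

variable (hg : ContDiff ℝ ∞ g) (hsupp : Function.support g ⊆ Icc c d)

include hg hsupp

theorem radialPrimitive_eventuallyEq_const (hx : ‖x‖ < c) :
    radialPrimitive g R =ᶠ[𝓝 x] fun _ => ∫ s in c..R, g s := by
  filter_upwards [continuous_norm.continuousAt.eventually (gt_mem_nhds hx)] with y hy
  exact radialPrimitive_eq_of_norm_le hg.continuous
    (fun s hs => Function.notMem_support.1 fun hmem => hs.not_ge (hsupp hmem).1) hy.le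

variable (hc : 0 < c)

include hc

theorem isTestFunction_radialPrimitive (hd : d < R) :
    IsTestFunction (ball 0 R) (radialPrimitive (N := N) g R) := by
  have htsupp : tsupport (radialPrimitive (N := N) g R) ⊆ closedBall 0 d := by
    refine closure_minimal (fun x hx => ?_) isClosed_closedBall
    refine mem_closedBall_zero_iff.2 (not_lt.1 fun hlt => hx ?_)
    refine intervalIntegral.integral_zero_ae (.of_forall fun s hs => ?_)
    exact Function.notMem_support.1 fun hmem =>
      ((lt_min hlt hd).trans hs.1).not_ge (hsupp hmem).2
  refine ⟨contDiff_iff_contDiffAt.2 fun x => ?_,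
    (isCompact_closedBall _ _).of_isClosed_subset (isClosed_tsupport _) htsupp,
    htsupp.trans (closedBall_subset_ball hd)⟩
  obtain hx | hx := lt_or_ge ‖x‖ c
  · exact contDiffAt_const.congr_of_eventuallyEq
      (radialPrimitive_eventuallyEq_const hg hsupp hx)
  · exact (contDiff_integral_left hg).contDiffAt.comp x
      (contDiffAt_norm ℝ (norm_pos_iff.1 (hc.trans_le hx)))

theorem gradient_radialPrimitive (x : EuclideanSpace ℝ (Fin N)) :
    ∇ (radialPrimitive g R) x = radialGradient g x := by
  obtain hx | hx := lt_or_ge ‖x‖ c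
  · have hgx : g ‖x‖ = 0 := Function.notMem_support.1 fun hmem => hx.not_ge (hsupp hmem).1
    rw [(radialPrimitive_eventuallyEq_const hg hsupp hx).gradient_eq, gradient_fun_const,
      radialGradient, hgx, neg_zero, zero_smul]
  · exact (hasGradientAt_radialPrimitive hg.continuous
      (norm_pos_iff.1 (hc.trans_le hx))).gradient

end CompactSupport

theorem tendsto_integral_of_bounded_tendsto {C : ℝ} {f : ℕ → ℝ → ℝ} (hf : ∀ k, Continuous (f k))
    (hC : ∀ k s, |f k s| ≤ C) (hlim : ∀ s < R, Tendsto (fun k => f k s) atTop (𝓝 (h s)))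
    (hr : r ≤ R) :
    Tendsto (fun k => ∫ s in r..R, f k s) atTop (𝓝 (∫ s in r..R, h s)) := by
  refine intervalIntegral.tendsto_integral_filter_of_dominated_convergence (fun _ => C)
    (.of_forall fun k => (hf k).aestronglyMeasurable)
    (.of_forall fun k => .of_forall fun s _ => hC k s) intervalIntegrable_const ?_
  filter_upwards [Measure.ae_ne volume R] with s hs hmem
  rw [uIoc_of_le hr] at hmem
  exact hlim s (hmem.2.lt_of_ne hs)

theorem memSobolevZero_radialPrimitive {a C : ℝ} (ha : 0 ≤ a) (hh : ContinuousOn h (Ioo a R))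
    (hzero : ∀ r ≤ a, h r = 0) (hC : ∀ r < R, |h r| ≤ C) (hp : 0 < p) :
    MemSobolevZero p (ball 0 R) (radialPrimitive (N := N) h R) (radialGradient h) := by
  obtain ⟨f, hf, hsupp, hfC, hlim⟩ := exists_contDiff_bounded_tendsto hh hzero hC
  choose c d hc hd hsupp using hsupp
  have hC0 : 0 ≤ C + 1 := (abs_nonneg _).trans (hfC 0 0)
  have hgrad := fun k => gradient_radialPrimitive (N := N) (R := R) (hf k) (hsupp k)
    (ha.trans_lt (hc k))
  refine memSobolevZero_of_bounded_tendsto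
    (fun k => isTestFunction_radialPrimitive (hf k) (hsupp k) (ha.trans_lt (hc k)) (hd k))
    (C := (C + 1) * R) (D := C + 1) (fun k => ?_) (fun k => ?_) ?_ ?_ hp
  · filter_upwards [ae_restrict_mem measurableSet_ball] with x hx
    have hxR := mem_ball_zero_iff.1 hx
    refine (intervalIntegral.norm_integral_le_of_norm_le_const fun s _ => hfC k s).trans ?_
    rw [abs_of_pos (sub_pos.2 hxR)]
    gcongr
    linarith [norm_nonneg x]
  · exact .of_forall fun x => by
      rw [hgrad]
      exact (norm_radialGradient_le x).trans (hfC k _)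
  · filter_upwards [ae_restrict_mem measurableSet_ball] with x hx
    exact tendsto_integral_of_bounded_tendsto (fun k => (hf k).continuous) hfC hlim
      (mem_ball_zero_iff.1 hx).le
  · filter_upwards [ae_restrict_mem measurableSet_ball] with x hx
    simp only [hgrad, radialGradient]
    exact (hlim ‖x‖ (mem_ball_zero_iff.1 hx)).neg.smul_const _

end RadialFunctions

section FluxEnergy

section SphereArea

open Module

variable {E : Type*} [NormedAddCommGroup E] [InnerProductSpace ℝ E] [FiniteDimensional ℝ E]
  [MeasurableSpace E] [BorelSpace E]

theorem volume_real_ball_one_pos : 0 < volume.real (ball (0 : E) 1) :=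
  ENNReal.toReal_pos (measure_ball_pos _ _ one_pos).ne' measure_ball_lt_top.ne

variable [Nontrivial E]

theorem sphereArea_pos {r : ℝ} (hr : 0 < r) : 0 < sphereArea E r :=
  mul_pos (mul_pos (Nat.cast_pos.2 finrank_pos) volume_real_ball_one_pos) (pow_pos hr _)

theorem continuousOn_sphereArea_rpow (q : ℝ) :
    ContinuousOn (fun r => sphereArea E r ^ q) (Ioi 0) := by
  refine ContinuousOn.rpow_const ?_ fun r hr => Or.inl (sphereArea_pos hr).ne'
  unfold sphereArea
  fun_prop

end SphereArea

theorem integrable_norm_rpow_of_memLp {α E : Type*} [MeasurableSpace α] {μ : Measure α}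
    [NormedAddCommGroup E] {f : α → E} {p : ℝ} (hp : 0 < p) (hf : MemLp f (ENNReal.ofReal p) μ) :
    Integrable (fun x => ‖f x‖ ^ p) μ := by
  simpa only [ENNReal.toReal_ofReal hp.le] using
    hf.integrable_norm_rpow (by simpa using hp) ENNReal.ofReal_ne_top

theorem holderConjugate_div_sub_one {p : ℝ} (hp : 1 < p) : p.HolderConjugate (p / (p - 1)) :=
  .conjExponent hp

/-- The energy of the flux field of `shell N a b` in `B_R`, for the exponent conjugate to `p`. -/
noncomputable def fluxEnergy (N : ℕ) (p a b R : ℝ) : ℝ :=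
  ∫ x in ball 0 R, ‖fluxField N a b x‖ ^ (p / (p - 1))

variable {N : ℕ} {p a b r R : ℝ}

theorem fluxEnergy_nonneg : 0 ≤ fluxEnergy N p a b R :=
  integral_nonneg fun _ => Real.rpow_nonneg (norm_nonneg _) _

variable [NeZero N]

theorem integral_shell_norm (ha : 0 ≤ a) (hab : a ≤ b) (f : ℝ → ℝ) :
    ∫ x in shell N a b, f ‖x‖ = ∫ r in a..b, sphereArea (EuclideanSpace ℝ (Fin N)) r * f r := by
  calc ∫ x in shell N a b, f ‖x‖
      = ∫ x : EuclideanSpace ℝ (Fin N), (Ioo a b).indicator f ‖x‖ :=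
        (integral_indicator (measurableSet_shell a b)).symm
    _ = ∫ r in Ioi (0 : ℝ), (Ioo a b).indicator
          (fun r => sphereArea (EuclideanSpace ℝ (Fin N)) r * f r) r := by
        rw [integral_fun_norm_addHaar, nsmul_eq_mul, smul_eq_mul, ← mul_assoc,
          ← integral_const_mul]
        simp only [indicator_mul_right, sphereArea, smul_eq_mul, mul_assoc]
    _ = ∫ r in a..b, sphereArea (EuclideanSpace ℝ (Fin N)) r * f r := by
        rw [setIntegral_indicator measurableSet_Ioo, intervalIntegral.integral_of_le hab,
          integral_Ioc_eq_integral_Ioo,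
          inter_eq_right.2 (show Ioo a b ⊆ Ioi 0 from fun r hr => ha.trans_lt hr.1)]

theorem volume_real_shell (ha : 0 ≤ a) (hab : a ≤ b) : volume.real (shell N a b) =
    volume.real (ball (0 : EuclideanSpace ℝ (Fin N)) 1) * (b ^ N - a ^ N) := by
  have hN : N - 1 + 1 = N := Nat.sub_add_cancel (NeZero.one_le)
  calc volume.real (shell N a b) = ∫ _ in shell N a b, (1 : ℝ) := by simp
    _ = ∫ r in a..b, sphereArea (EuclideanSpace ℝ (Fin N)) r := by
        simpa only [mul_one] using integral_shell_norm ha hab fun _ => 1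
    _ = volume.real (ball (0 : EuclideanSpace ℝ (Fin N)) 1) * (b ^ N - a ^ N) := by
        simp only [sphereArea, finrank_euclideanSpace_fin]
        rw [intervalIntegral.integral_const_mul, integral_pow, ← Nat.cast_add_one, hN]
        field_simp [NeZero.ne (N : ℝ)]

theorem volume_real_shell_pos (ha : 0 ≤ a) (hab : a < b) : 0 < volume.real (shell N a b) := by
  rw [volume_real_shell ha hab.le]
  exact mul_pos volume_real_ball_one_pos (sub_pos.2 (pow_lt_pow_left₀ hab ha (NeZero.ne N)))

theorem shellFlux_eq_volume_div_sphereArea (ha : 0 ≤ a) (hab : a ≤ b) (hr : b ≤ r) :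
    shellFlux N a b r =
      volume.real (shell N a b) / sphereArea (EuclideanSpace ℝ (Fin N)) r := by
  rw [shellFlux_of_ge hab hr, volume_real_shell ha hab, sphereArea, finrank_euclideanSpace_fin,
    mul_right_comm, mul_comm _ (volume.real _), mul_div_mul_left _ _ volume_real_ball_one_pos.ne']

theorem shellFlux_le_volume_div_sphereArea (ha : 0 ≤ a) (hr : r ∈ Ioc a b) :
    shellFlux N a b r ≤
      volume.real (shell N a b) / sphereArea (EuclideanSpace ℝ (Fin N)) b := by
  have hab : a < b := hr.1.trans_le hr.2
  have hr0 : 0 < r := ha.trans_lt hr.1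
  rw [← shellFlux_eq_volume_div_sphereArea ha hab.le le_rfl,
    shellFlux_of_mem_Ioc (NeZero.ne N) ha hr,
    shellFlux_of_mem_Ioc (NeZero.ne N) ha (right_mem_Ioc.2 hab)]
  have hrb : r ≤ b := hr.2
  have hb : 0 < b := hr0.trans_le hrb
  have hpow_le : (a / b) ^ N ≤ (a / r) ^ N :=
    pow_le_pow_left₀ (by positivity) (div_le_div_of_nonneg_left ha hr0 hrb) N
  gcongr
  exact sub_nonneg.2 (pow_le_one₀ (by positivity) (div_le_one_of_le₀ hr.1.le hr0.le))

/-- The integral `∫_b^R |∂B_r|^{-1/(p-1)} dr`, a negative power of the `p`-capacity of `B_b` in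
`B_R`. -/
noncomputable def capacityIntegral (N : ℕ) (p b R : ℝ) : ℝ :=
  ∫ r in b..R, sphereArea (EuclideanSpace ℝ (Fin N)) r ^ (-(1 / (p - 1)))

theorem capacityIntegral_pos (hb : 0 < b) (hbR : b < R) : 0 < capacityIntegral N p b R := by
  refine intervalIntegral.intervalIntegral_pos_of_pos_on (ContinuousOn.intervalIntegrable ?_)
    (fun r hr => Real.rpow_pos_of_pos (sphereArea_pos (hb.trans hr.1)) _) hbR
  rw [uIcc_of_le hbR.le]
  exact (continuousOn_sphereArea_rpow _).mono fun r hr => hb.trans_le hr.1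

theorem memLp_fluxField (ha : 0 ≤ a) (q : ℝ≥0∞) :
    MemLp (fluxField N a b) q (volume.restrict (ball 0 R)) :=
  .of_bound measurable_fluxField.aestronglyMeasurable R (ae_norm_fluxField_le ha)

theorem rpow_mul_rpow_neg_one_div {s t : ℝ} (hs : 0 < s) (ht : 0 ≤ t) (hp : 1 < p) :
    s * (t / s) ^ (p / (p - 1)) = t ^ (p / (p - 1)) * s ^ (-(1 / (p - 1))) := by
  have hexp : -(1 / (p - 1)) = 1 - p / (p - 1) := by
    field_simp [(sub_pos.2 hp).ne']
    ring
  rw [Real.div_rpow ht hs.le, hexp, Real.rpow_sub hs, Real.rpow_one]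
  ring

theorem integral_outer_shell_fluxField (hp : 1 < p) (ha : 0 ≤ a) (hab : a < b) (hbR : b < R) :
    ∫ x in shell N b R, ‖fluxField N a b x‖ ^ (p / (p - 1)) =
      volume.real (shell N a b) ^ (p / (p - 1)) * capacityIntegral N p b R := by
  have hb : 0 < b := ha.trans_lt hab
  simp only [norm_fluxField ha]
  rw [integral_shell_norm hb.le hbR.le fun r => shellFlux N a b r ^ (p / (p - 1)),
    capacityIntegral, ← intervalIntegral.integral_const_mul]
  refine intervalIntegral.integral_congr fun r hr => ?_
  rw [uIcc_of_le hbR.le] at hr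
  beta_reduce
  rw [shellFlux_eq_volume_div_sphereArea ha hab.le hr.1]
  exact rpow_mul_rpow_neg_one_div (sphereArea_pos (hb.trans_le hr.1)) measureReal_nonneg hp

theorem fluxEnergy_eq_integral_shell_add (hp : 1 < p) (ha : 0 ≤ a) (hab : a < b) (hbR : b < R) :
    fluxEnergy N p a b R = (∫ x in shell N a b, ‖fluxField N a b x‖ ^ (p / (p - 1))) +
      volume.real (shell N a b) ^ (p / (p - 1)) * capacityIntegral N p b R := by
  have hq : 0 < p / (p - 1) := (holderConjugate_div_sub_one hp).symm.pos
  have hint := integrable_norm_rpow_of_memLp hq (memLp_fluxField (N := N) (b := b) (R := R) ha _)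
  rw [fluxEnergy, ← integral_inter_add_sdiff (measurableSet_shell a b) hint,
    inter_eq_right.2 (shell_subset_ball hbR.le), ← integral_outer_shell_fluxField hp ha hab hbR]
  congr 1
  refine setIntegral_eq_of_subset_of_ae_sdiff_eq_zero
    (measurableSet_ball.diff (measurableSet_shell a b)).nullMeasurableSet
    (fun x hx => ⟨shell_subset_ball le_rfl hx, fun h => hx.1.not_gt h.2⟩) ?_
  filter_upwards [compl_mem_ae_iff.2 (Measure.addHaar_sphere volume 0 b)] with x hxb hx
  have hxa : ‖x‖ ≤ a := by
    by_contra! hax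
    obtain hlt | heq | hgt := lt_trichotomy ‖x‖ b
    · exact hx.1.2 ⟨hax, hlt⟩
    · exact hxb (mem_sphere_zero_iff_norm.2 heq)
    · exact hx.2 ⟨hgt, mem_ball_zero_iff.1 hx.1.1⟩
  rw [norm_fluxField ha, shellFlux_of_le hxa, Real.zero_rpow hq.ne']

theorem fluxEnergy_eq (hp : 1 < p) (ha : 0 ≤ a) (hab : a < b) (hbR : b < R) :
    fluxEnergy N p a b R =
      (∫ x in shell N a b, (‖x‖ / N * (1 - (a / ‖x‖) ^ N)) ^ (p / (p - 1))) +
        volume.real (shell N a b) ^ (p / (p - 1)) * capacityIntegral N p b R := by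
  rw [fluxEnergy_eq_integral_shell_add hp ha hab hbR]
  congr 1
  refine setIntegral_congr_fun (measurableSet_shell a b) fun x hx => ?_
  rw [norm_fluxField ha, shellFlux_of_mem_Ioc (NeZero.ne N) ha ⟨hx.1, hx.2.le⟩]

theorem fluxEnergy_pos (hp : 1 < p) (ha : 0 ≤ a) (hab : a < b) (hbR : b < R) :
    0 < fluxEnergy N p a b R := by
  rw [fluxEnergy_eq_integral_shell_add hp ha hab hbR]
  exact add_pos_of_nonneg_of_pos (integral_nonneg fun _ => Real.rpow_nonneg (norm_nonneg _) _)
    (mul_pos (Real.rpow_pos_of_pos (volume_real_shell_pos ha hab) _)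
      (capacityIntegral_pos (ha.trans_lt hab) hbR))

theorem fluxEnergy_le {s : ℝ} (hp : 1 < p) (ha : 0 ≤ a) (hab : a < b) (hbR : b < R)
    (hs : s ∈ Ioc 0 (sphereArea (EuclideanSpace ℝ (Fin N)) b)) :
    fluxEnergy N p a b R ≤ volume.real (shell N a b) ^ (p / (p - 1)) *
      (volume.real (shell N a b) / s ^ (p / (p - 1)) + capacityIntegral N p b R) := by
  have hq : 0 < p / (p - 1) := (holderConjugate_div_sub_one hp).symm.pos
  have hbound : ∀ x ∈ shell N a b, ‖‖fluxField N a b x‖ ^ (p / (p - 1))‖ ≤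
      (volume.real (shell N a b) / s) ^ (p / (p - 1)) := fun x hx => by
    rw [Real.norm_of_nonneg (by positivity), norm_fluxField ha]
    refine Real.rpow_le_rpow (shellFlux_nonneg ha (norm_nonneg x)) ?_ hq.le
    exact (shellFlux_le_volume_div_sphereArea ha ⟨hx.1, hx.2.le⟩).trans
      (div_le_div_of_nonneg_left measureReal_nonneg hs.1 hs.2)
  have hint := norm_setIntegral_le_of_norm_le_const (volume_shell_ne_top a b).lt_top hbound
  rw [fluxEnergy_eq_integral_shell_add hp ha hab hbR, mul_add]
  gcongr
  refine (Real.le_norm_self _).trans (hint.trans_eq ?_)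
  rw [Real.div_rpow measureReal_nonneg hs.1.le]
  ring

end FluxEnergy

section Poincare

variable {N : ℕ} [NeZero N] {p a b R : ℝ} {u : EuclideanSpace ℝ (Fin N) → ℝ}
  {G : EuclideanSpace ℝ (Fin N) → EuclideanSpace ℝ (Fin N)}

theorem MemSobolevZero.integral_shell_abs_rpow_le (h : MemSobolevZero p (ball 0 R) u G)
    (hp : 1 < p) (ha : 0 ≤ a) (hbR : b ≤ R) :
    (∫ x in shell N a b, |u x|) ^ p ≤
      fluxEnergy N p a b R ^ (p - 1) * ∫ x in ball 0 R, ‖G x‖ ^ p := by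
  have hpq := holderConjugate_div_sub_one hp
  have hhoelder := integral_mul_le_Lp_mul_Lq_of_nonneg hpq
    (.of_forall fun x => norm_nonneg (G x)) (.of_forall fun x => norm_nonneg (fluxField N a b x))
    h.1.2.1.norm (memLp_fluxField (R := R) ha _).norm
  have hG : 0 ≤ ∫ x in ball 0 R, ‖G x‖ ^ p := by positivity
  have hE : 0 ≤ fluxEnergy N p a b R := fluxEnergy_nonneg
  calc (∫ x in shell N a b, |u x|) ^ p
      ≤ ((∫ x in ball 0 R, ‖G x‖ ^ p) ^ (1 / p) *
          fluxEnergy N p a b R ^ (1 / (p / (p - 1)))) ^ p := by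
        refine Real.rpow_le_rpow (by positivity) ?_ hpq.nonneg
        exact (h.integral_shell_abs_le ha hbR hp.le).trans hhoelder
    _ = fluxEnergy N p a b R ^ (p - 1) * ∫ x in ball 0 R, ‖G x‖ ^ p := by
        rw [Real.mul_rpow (by positivity) (by positivity), ← Real.rpow_mul hG,
          ← Real.rpow_mul hE, one_div_mul_cancel hpq.ne_zero, Real.rpow_one, mul_comm,
          one_div_div, div_mul_cancel₀ _ hpq.ne_zero]

theorem MemSobolevZero.average_shell_abs_rpow_le {s : ℝ} (h : MemSobolevZero p (ball 0 R) u G)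
    (hp : 1 < p) (ha : 0 ≤ a) (hab : a < b) (hbR : b < R)
    (hs : s ∈ Ioc 0 (sphereArea (EuclideanSpace ℝ (Fin N)) b)) :
    (⨍ x in shell N a b, |u x|) ^ p ≤
      (volume.real (shell N a b) / s ^ (p / (p - 1)) + capacityIntegral N p b R) ^ (p - 1) *
        ∫ x in ball 0 R, ‖G x‖ ^ p := by
  have hS := volume_real_shell_pos (N := N) ha hab
  have hT := capacityIntegral_pos (N := N) (p := p) (ha.trans_lt hab) hbR
  have hs0 := hs.1
  have hp1 : 0 < p - 1 := sub_pos.2 hp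
  rw [setAverage_eq, smul_eq_mul, Real.mul_rpow (by positivity) (by positivity),
    Real.inv_rpow hS.le, inv_mul_le_iff₀ (by positivity), ← mul_assoc]
  refine (h.integral_shell_abs_rpow_le hp ha hbR.le).trans ?_
  gcongr
  refine (Real.rpow_le_rpow fluxEnergy_nonneg (fluxEnergy_le hp ha hab hbR hs) hp1.le).trans_eq ?_
  rw [Real.mul_rpow (by positivity) (by positivity), ← Real.rpow_mul hS.le,
    div_mul_cancel₀ _ hp1.ne']

end Poincare

section Capacity

open Filter
open scoped Topology

section TestFunction

variable {N : ℕ} {p b c d R : ℝ} {K Ω : Set (EuclideanSpace ℝ (Fin N))}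
  {φ : EuclideanSpace ℝ (Fin N) → ℝ} {g h : ℝ → ℝ}

theorem relCapacity_le (hφ : IsTestFunction Ω φ) (hK : ∀ x ∈ K, 1 ≤ φ x) :
    relCapacity p K Ω ≤ ∫ x in Ω, ‖∇ φ x‖ ^ p := by
  refine csInf_le ⟨0, ?_⟩ ⟨φ, hφ, hK, rfl⟩
  rintro _ ⟨ψ, -, -, rfl⟩
  positivity

theorem exists_isTestFunction_one_le (hb : 0 < b) (hbR : b < R) :
    ∃ φ : EuclideanSpace ℝ (Fin N) → ℝ,
      IsTestFunction (ball 0 R) φ ∧ ∀ x ∈ closedBall 0 b, 1 ≤ φ x := by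
  let f : ContDiffBump (0 : EuclideanSpace ℝ (Fin N)) :=
    ⟨b, (b + R) / 2, hb, left_lt_add_div_two.2 hbR⟩
  refine ⟨f, ⟨f.contDiff, f.hasCompactSupport, ?_⟩, fun x hx => (f.one_of_mem_closedBall hx).ge⟩
  rw [f.tsupport_eq]
  exact closedBall_subset_ball (add_div_two_lt_right.2 hbR)

theorem relCapacity_mul_integral_rpow_le_of_contDiff (hg : ContDiff ℝ ∞ g)
    (hsupp : Function.support g ⊆ Icc c d) (hb : 0 ≤ b) (hbc : b < c) (hd : d < R)
    (hpos : 0 < ∫ r in b..R, g r) :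
    relCapacity p (closedBall (0 : EuclideanSpace ℝ (Fin N)) b) (ball 0 R) *
      (∫ r in b..R, g r) ^ p ≤ ∫ x in ball (0 : EuclideanSpace ℝ (Fin N)) R, |g ‖x‖| ^ p := by
  set I := ∫ r in b..R, g r
  have hzero : ∀ r < c, g r = 0 := fun r hr =>
    Function.notMem_support.1 fun hmem => hr.not_ge (hsupp hmem).1
  have hc : 0 < c := hb.trans_lt hbc
  have hgI : ContDiff ℝ ∞ fun r => g r / I := hg.div_const I
  have hsuppI : Function.support (fun r => g r / I) ⊆ Icc c d := fun r hr =>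
    hsupp fun h0 => hr (by simp only [h0, zero_div])
  have hone : ∀ x ∈ closedBall (0 : EuclideanSpace ℝ (Fin N)) b,
      1 ≤ radialPrimitive (fun r => g r / I) R x := fun x hx => by
    rw [radialPrimitive_eq_of_norm_le hgI.continuous
      (fun r hr => by rw [hzero r (hr.trans hbc), zero_div]) (mem_closedBall_zero_iff.1 hx),
      intervalIntegral.integral_div, div_self hpos.ne']
  have henergy : ∫ x in ball (0 : EuclideanSpace ℝ (Fin N)) R,
      ‖∇ (radialPrimitive (fun r => g r / I) R) x‖ ^ p =
        (∫ x in ball (0 : EuclideanSpace ℝ (Fin N)) R, |g ‖x‖| ^ p) / I ^ p := by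
    rw [← integral_div]
    refine integral_congr_ae (.of_forall fun x => ?_)
    beta_reduce
    rw [gradient_radialPrimitive hgI hsuppI hc,
      norm_radialGradient (by rw [hzero 0 hc, zero_div]), abs_div, abs_of_pos hpos,
      Real.div_rpow (abs_nonneg _) hpos.le]
  rw [← le_div_iff₀ (Real.rpow_pos_of_pos hpos p), ← henergy]
  exact relCapacity_le (isTestFunction_radialPrimitive hgI hsuppI hc hd) hone

theorem relCapacity_mul_integral_rpow_le {C : ℝ} (hb : 0 ≤ b) (hbR : b ≤ R) (hp : 0 ≤ p)
    (hh : ContinuousOn h (Ioo b R)) (hzero : ∀ r ≤ b, h r = 0) (hC : ∀ r < R, |h r| ≤ C)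
    (hpos : 0 < ∫ r in b..R, h r) :
    relCapacity p (closedBall (0 : EuclideanSpace ℝ (Fin N)) b) (ball 0 R) *
      (∫ r in b..R, h r) ^ p ≤ ∫ x in ball (0 : EuclideanSpace ℝ (Fin N)) R, |h ‖x‖| ^ p := by
  obtain ⟨f, hf, hsupp, hfC, hlim⟩ := exists_contDiff_bounded_tendsto hh hzero hC
  have hintegral := tendsto_integral_of_bounded_tendsto (fun k => (hf k).continuous) hfC hlim hbR
  have henergy : Tendsto (fun k => ∫ x in ball (0 : EuclideanSpace ℝ (Fin N)) R, |f k ‖x‖| ^ p)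
      atTop (𝓝 (∫ x in ball (0 : EuclideanSpace ℝ (Fin N)) R, |h ‖x‖| ^ p)) := by
    refine tendsto_integral_of_dominated_convergence (fun _ => (C + 1) ^ p) (fun k => ?_)
      (integrable_const _) (fun k => .of_forall fun x => ?_) ?_
    · exact (((hf k).continuous.comp continuous_norm).abs.rpow_const
        fun _ => Or.inr hp).aestronglyMeasurable
    · rw [Real.norm_of_nonneg (by positivity)]
      exact Real.rpow_le_rpow (abs_nonneg _) (hfC k _) hp
    · filter_upwards [ae_restrict_mem measurableSet_ball] with x hx
      exact (hlim ‖x‖ (mem_ball_zero_iff.1 hx)).abs.rpow_const (Or.inr hp)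
  refine le_of_tendsto_of_tendsto ((hintegral.rpow_const (Or.inr hp)).const_mul _) henergy ?_
  filter_upwards [hintegral.eventually (lt_mem_nhds hpos)] with k hk
  obtain ⟨c, d, hc, hd, hsuppk⟩ := hsupp k
  exact relCapacity_mul_integral_rpow_le_of_contDiff (hf k) hsuppk hb hc hd hk

end TestFunction

variable {N : ℕ} [NeZero N] {p a b R : ℝ} {φ : EuclideanSpace ℝ (Fin N) → ℝ}

theorem integral_ball_norm_of_forall_le_eq_zero (hb : 0 ≤ b) (hbR : b ≤ R) {f : ℝ → ℝ}
    (hf : ∀ r ≤ b, f r = 0) : ∫ x in ball (0 : EuclideanSpace ℝ (Fin N)) R, f ‖x‖ =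
      ∫ r in b..R, sphereArea (EuclideanSpace ℝ (Fin N)) r * f r := by
  rw [← integral_shell_norm hb hbR]
  refine setIntegral_eq_of_subset_of_forall_sdiff_eq_zero measurableSet_ball
    (shell_subset_ball le_rfl) fun x hx => hf _ ?_
  exact le_of_not_gt fun hxb => hx.2 ⟨hxb, mem_ball_zero_iff.1 hx.1⟩

theorem mul_rpow_neg_one_div_rpow {s : ℝ} (hs : 0 < s) (hp : 1 < p) :
    s * (s ^ (-(1 / (p - 1)))) ^ p = s ^ (-(1 / (p - 1))) := by
  have hexp : -(1 / (p - 1)) * p = -(1 / (p - 1)) - 1 := by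
    field_simp [(sub_pos.2 hp).ne']
    ring
  rw [← Real.rpow_mul hs.le, hexp, Real.rpow_sub_one hs.ne', mul_div_cancel₀ _ hs.ne']

theorem relCapacity_closedBall_mul_capacityIntegral_rpow_le (hp : 1 < p) (hb : 0 < b)
    (hbR : b < R) :
    relCapacity p (closedBall (0 : EuclideanSpace ℝ (Fin N)) b) (ball 0 R) *
      capacityIntegral N p b R ^ p ≤ capacityIntegral N p b R := by
  have hp0 : 0 < p := one_pos.trans hp
  set f : ℝ → ℝ := fun r => sphereArea (EuclideanSpace ℝ (Fin N)) r ^ (-(1 / (p - 1)))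
  set h : ℝ → ℝ := (Ioi b).indicator f
  have hh : ∀ r, b < r → h r = f r := fun r hr => indicator_of_mem (mem_Ioi.2 hr) f
  have hzero : ∀ r ≤ b, h r = 0 := fun r hr => indicator_of_notMem (notMem_Ioi.2 hr) f
  have hf : ContinuousOn f (Icc b R) :=
    (continuousOn_sphereArea_rpow _).mono fun r hr => hb.trans_le hr.1
  obtain ⟨C, hC⟩ := isCompact_Icc.exists_bound_of_continuousOn hf
  have hbound : ∀ r < R, |h r| ≤ C := fun r hr => by
    obtain hrb | hrb := le_or_gt r b
    · rw [hzero r hrb, abs_zero]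
      exact (norm_nonneg _).trans (hC b (left_mem_Icc.2 hbR.le))
    · rw [hh r hrb]
      exact hC r ⟨hrb.le, hr.le⟩
  have hintegral : ∫ r in b..R, h r = capacityIntegral N p b R := by
    refine intervalIntegral.integral_congr_ae (.of_forall fun r hr => hh r ?_)
    exact (uIoc_of_le hbR.le ▸ hr).1
  have henergy : ∫ x in ball (0 : EuclideanSpace ℝ (Fin N)) R, |h ‖x‖| ^ p =
      capacityIntegral N p b R := by
    rw [integral_ball_norm_of_forall_le_eq_zero hb.le hbR.le (f := fun r => |h r| ^ p)
      fun r hr => by rw [hzero r hr, abs_zero, Real.zero_rpow hp0.ne']]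
    refine intervalIntegral.integral_congr_ae (.of_forall fun r hr => ?_)
    have hr : b < r := (uIoc_of_le hbR.le ▸ hr).1
    have hs : 0 < sphereArea (EuclideanSpace ℝ (Fin N)) r := sphereArea_pos (hb.trans hr)
    rw [hh r hr, abs_of_pos (Real.rpow_pos_of_pos hs _), mul_rpow_neg_one_div_rpow hs hp]
  have hcap := relCapacity_mul_integral_rpow_le (N := N) hb.le hbR.le hp0.le
    ((hf.mono Ioo_subset_Icc_self).congr fun r hr => hh r hr.1) hzero hbound
    ((capacityIntegral_pos hb hbR).trans_eq hintegral.symm)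
  rwa [hintegral, henergy] at hcap

theorem tendsto_volume_real_shell (hb : 0 < b) :
    Tendsto (fun a => volume.real (shell N a b)) (𝓝[<] b) (𝓝 0) := by
  have hcont : Continuous fun a : ℝ =>
      volume.real (ball (0 : EuclideanSpace ℝ (Fin N)) 1) * (b ^ N - a ^ N) := by fun_prop
  have hlim := (hcont.tendsto b).mono_left (nhdsWithin_le_nhds (s := Iio b))
  rw [sub_self, mul_zero] at hlim
  refine hlim.congr' ?_
  filter_upwards [Ioo_mem_nhdsLT hb] with a ha
  exact (volume_real_shell ha.1.le ha.2.le).symm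

theorem one_le_average_shell_abs (hφ : IsTestFunction (ball 0 R) φ)
    (hone : ∀ x ∈ closedBall 0 b, 1 ≤ φ x) (ha : 0 ≤ a) (hab : a < b) :
    1 ≤ ⨍ x in shell N a b, |φ x| := by
  have hvol := volume_real_shell_pos (N := N) ha hab
  rw [setAverage_eq, smul_eq_mul, inv_mul_eq_div, one_le_div hvol]
  calc volume.real (shell N a b) = ∫ _ in shell N a b, (1 : ℝ) := by simp
    _ ≤ ∫ x in shell N a b, |φ x| :=
        setIntegral_mono_on (integrableOn_const (volume_shell_ne_top a b))
          (memLp_one_iff_integrable.1 (hφ.memLp 1 _)).abs (measurableSet_shell a b) fun x hx =>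
            (hone x (mem_closedBall_zero_iff.2 hx.2.le)).trans (le_abs_self _)

theorem one_le_capacityIntegral_rpow_mul_integral (hφ : IsTestFunction (ball 0 R) φ)
    (hone : ∀ x ∈ closedBall 0 b, 1 ≤ φ x) (hp : 1 < p) (hb : 0 < b) (hbR : b < R) :
    1 ≤ capacityIntegral N p b R ^ (p - 1) * ∫ x in ball 0 R, ‖∇ φ x‖ ^ p := by
  have hlim := ((((tendsto_volume_real_shell (N := N) hb).div_const
    (sphereArea (EuclideanSpace ℝ (Fin N)) b ^ (p / (p - 1)))).add_const
      (capacityIntegral N p b R)).rpow_const (p := p - 1) (Or.inr (sub_pos.2 hp).le)).mul_const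
        (∫ x in ball 0 R, ‖∇ φ x‖ ^ p)
  rw [zero_div, zero_add] at hlim
  refine ge_of_tendsto hlim ?_
  filter_upwards [Ioo_mem_nhdsLT hb] with a ha
  calc (1 : ℝ) ≤ (⨍ x in shell N a b, |φ x|) ^ p :=
        Real.one_le_rpow (one_le_average_shell_abs hφ hone ha.1.le ha.2) (by linarith)
    _ ≤ _ := hφ.memSobolevZero.average_shell_abs_rpow_le hp ha.1.le ha.2 hbR
        (right_mem_Ioc.2 (sphereArea_pos hb))

theorem relCapacity_closedBall (hp : 1 < p) (hb : 0 < b) (hbR : b < R) :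
    relCapacity p (closedBall (0 : EuclideanSpace ℝ (Fin N)) b) (ball 0 R) =
      (capacityIntegral N p b R ^ (p - 1))⁻¹ := by
  have hT := capacityIntegral_pos (N := N) (p := p) hb hbR
  refine le_antisymm ?_ (le_csInf ?_ ?_)
  · rw [← one_div, le_div_iff₀ (by positivity), Real.rpow_sub_one hT.ne', ← mul_div_assoc]
    exact div_le_one_of_le₀ (relCapacity_closedBall_mul_capacityIntegral_rpow_le hp hb hbR) hT.le
  · obtain ⟨φ, hφ, hone⟩ := exists_isTestFunction_one_le (N := N) hb hbR
    exact ⟨_, φ, hφ, hone, rfl⟩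
  · rintro _ ⟨φ, hφ, hone, rfl⟩
    exact (inv_le_iff_one_le_mul₀' (by positivity)).2
      (one_le_capacityIntegral_rpow_mul_integral hφ hone hp hb hbR)

theorem one_div_relCapacity_closedBall_rpow (hp : 1 < p) (hb : 0 < b) (hbR : b < R) :
    (1 / relCapacity p (closedBall (0 : EuclideanSpace ℝ (Fin N)) b) (ball 0 R)) ^ (1 / (p - 1)) =
      capacityIntegral N p b R := by
  have hT := capacityIntegral_pos (N := N) (p := p) hb hbR
  rw [relCapacity_closedBall hp hb hbR, one_div, inv_inv, ← Real.rpow_mul hT.le,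
    mul_one_div_cancel (sub_pos.2 hp).ne', Real.rpow_one]

end Capacity

section Young

open scoped RealInnerProductSpace

variable {E : Type*} [NormedAddCommGroup E] [InnerProductSpace ℝ E] {p q : ℝ}

theorem inner_le_norm_rpow_div_add_norm_rpow_div (hpq : p.HolderConjugate q) (ξ η : E) :
    ⟪ξ, η⟫ ≤ ‖ξ‖ ^ p / p + ‖η‖ ^ q / q :=
  (real_inner_le_norm ξ η).trans
    (Real.young_inequality_of_nonneg (norm_nonneg ξ) (norm_nonneg η) hpq)

theorem inner_eq_norm_rpow_div_add_norm_rpow_div_iff (hpq : p.HolderConjugate q) {ξ η : E} :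
    ⟪ξ, η⟫ = ‖ξ‖ ^ p / p + ‖η‖ ^ q / q ↔ ‖ξ‖ ^ p = ‖η‖ ^ q ∧ ‖η‖ • ξ = ‖ξ‖ • η := by
  rw [← inner_eq_norm_mul_iff_real,
    ← Real.young_inequality_eq_iff_of_nonneg (norm_nonneg ξ) (norm_nonneg η) hpq]
  have hcs := real_inner_le_norm ξ η
  have hyoung := Real.young_inequality_of_nonneg (norm_nonneg ξ) (norm_nonneg η) hpq
  exact ⟨fun h => ⟨by linarith, by linarith⟩, fun ⟨h, h'⟩ => h'.trans h⟩

theorem inner_eq_norm_rpow_div_add_norm_rpow_div_iff_eq_smul (hpq : p.HolderConjugate q)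
    {ξ η : E} : ⟪ξ, η⟫ = ‖ξ‖ ^ p / p + ‖η‖ ^ q / q ↔
      ξ = ‖η‖ ^ (q - 1) • NormedSpace.normalize η := by
  rw [inner_eq_norm_rpow_div_add_norm_rpow_div_iff hpq]
  obtain rfl | hη := eq_or_ne η 0
  · simp [Real.zero_rpow hpq.symm.ne_zero, Real.rpow_eq_zero (norm_nonneg ξ) hpq.ne_zero]
  have hη' : ‖η‖ ≠ 0 := norm_ne_zero_iff.2 hη
  have hnorm : ‖ξ‖ ^ p = ‖η‖ ^ q ↔ ‖ξ‖ = ‖η‖ ^ (q - 1) := by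
    rw [← Real.rpow_left_inj (norm_nonneg ξ) (by positivity) hpq.ne_zero,
      ← Real.rpow_mul (norm_nonneg η), sub_mul, one_mul, mul_comm, hpq.mul_eq_add,
      add_sub_cancel_left]
  rw [hnorm]
  constructor
  · rintro ⟨hξ, hcol⟩
    rw [← hξ, NormedSpace.normalize, smul_comm, ← hcol, inv_smul_smul₀ hη']
  · intro hξ
    have hξn : ‖ξ‖ = ‖η‖ ^ (q - 1) := by
      rw [hξ, norm_smul, NormedSpace.norm_normalize hη, mul_one,
        Real.norm_of_nonneg (by positivity)]
    refine ⟨hξn, ?_⟩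
    rw [hξn, hξ, smul_comm, NormedSpace.normalize, smul_inv_smul₀ hη']

end Young

section Torsion

open scoped RealInnerProductSpace

variable {N : ℕ} {p a b r R : ℝ}

/-- The modulus of the gradient of the torsion function, as a function of `r = |x|`. -/
noncomputable def torsionSlope (N : ℕ) (p a b r : ℝ) : ℝ :=
  shellFlux N a b r ^ (p / (p - 1) - 1)

/-- The explicit minimizer of the torsion functional of `shell N a b` in `B_R`. -/
noncomputable def torsionFunction (N : ℕ) (p a b R : ℝ) : EuclideanSpace ℝ (Fin N) → ℝ :=
  radialPrimitive (torsionSlope N p a b) R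

/-- The gradient of `torsionFunction N p a b R`, which does not depend on `R`. -/
noncomputable def torsionGradient (N : ℕ) (p a b : ℝ) :
    EuclideanSpace ℝ (Fin N) → EuclideanSpace ℝ (Fin N) :=
  radialGradient (torsionSlope N p a b)

theorem torsionSlope_nonneg (ha : 0 ≤ a) (hr : 0 ≤ r) : 0 ≤ torsionSlope N p a b r :=
  Real.rpow_nonneg (shellFlux_nonneg ha hr) _

theorem torsionSlope_of_le (hp : 1 < p) (h : r ≤ a) : torsionSlope N p a b r = 0 := by
  rw [torsionSlope, shellFlux_of_le h,
    Real.zero_rpow (holderConjugate_div_sub_one hp).symm.sub_one_ne_zero]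

theorem torsionFunction_nonneg (ha : 0 ≤ a) {x : EuclideanSpace ℝ (Fin N)} (hx : ‖x‖ ≤ R) :
    0 ≤ torsionFunction N p a b R x :=
  intervalIntegral.integral_nonneg hx fun _ hr =>
    torsionSlope_nonneg ha ((norm_nonneg x).trans hr.1)

theorem torsionGradient_eq (hp : 1 < p) (ha : 0 ≤ a) (x : EuclideanSpace ℝ (Fin N)) :
    torsionGradient N p a b x = ‖-fluxField N a b x‖ ^ (p / (p - 1) - 1) •
      NormedSpace.normalize (-fluxField N a b x) := by
  rw [norm_neg, norm_fluxField ha, torsionGradient, radialGradient, torsionSlope, neg_smul,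
    ← smul_neg]
  obtain h | h := (shellFlux_nonneg (n := N) (b := b) ha (norm_nonneg x)).eq_or_lt
  · rw [← h, Real.zero_rpow (holderConjugate_div_sub_one hp).symm.sub_one_ne_zero,
      zero_smul, zero_smul]
  · rw [NormedSpace.normalize_neg, fluxField, NormedSpace.normalize_smul_of_pos h,
      NormedSpace.normalize_normalize]

theorem inner_torsionGradient_neg_fluxField (hp : 1 < p) (ha : 0 ≤ a)
    (x : EuclideanSpace ℝ (Fin N)) :
    ⟪torsionGradient N p a b x, -fluxField N a b x⟫ =
      ‖torsionGradient N p a b x‖ ^ p / p + ‖-fluxField N a b x‖ ^ (p / (p - 1)) / (p / (p - 1)) :=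
  (inner_eq_norm_rpow_div_add_norm_rpow_div_iff_eq_smul
    (holderConjugate_div_sub_one hp)).2 (torsionGradient_eq hp ha x)

theorem norm_torsionGradient_rpow (hp : 1 < p) (ha : 0 ≤ a) (x : EuclideanSpace ℝ (Fin N)) :
    ‖torsionGradient N p a b x‖ ^ p = ‖fluxField N a b x‖ ^ (p / (p - 1)) := by
  rw [((inner_eq_norm_rpow_div_add_norm_rpow_div_iff
    (holderConjugate_div_sub_one hp)).1 (inner_torsionGradient_neg_fluxField hp ha x)).1,
    norm_neg]

theorem integral_norm_torsionGradient_rpow (hp : 1 < p) (ha : 0 ≤ a) :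
    ∫ x in ball 0 R, ‖torsionGradient N p a b x‖ ^ p = fluxEnergy N p a b R := by
  simp only [norm_torsionGradient_rpow hp ha, fluxEnergy]

variable {u u' : EuclideanSpace ℝ (Fin N) → ℝ}
  {G G' : EuclideanSpace ℝ (Fin N) → EuclideanSpace ℝ (Fin N)}

/-- The nonnegative defect in Young's inequality for `⟪G, -X⟫`, where `X` is the flux field of
`shell N a b`; its integral measures how far `G` is from minimizing the torsion functional. -/
noncomputable def torsionDefect (p a b : ℝ)
    (G : EuclideanSpace ℝ (Fin N) → EuclideanSpace ℝ (Fin N)) (x : EuclideanSpace ℝ (Fin N)) : ℝ :=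
  ‖G x‖ ^ p / p + ‖-fluxField N a b x‖ ^ (p / (p - 1)) / (p / (p - 1)) -
    ⟪G x, -fluxField N a b x⟫

theorem torsionDefect_nonneg (hp : 1 < p) (x : EuclideanSpace ℝ (Fin N)) :
    0 ≤ torsionDefect p a b G x :=
  sub_nonneg.2 (inner_le_norm_rpow_div_add_norm_rpow_div (holderConjugate_div_sub_one hp) _ _)

theorem torsionDefect_eq_zero_iff (hp : 1 < p) (ha : 0 ≤ a) {x : EuclideanSpace ℝ (Fin N)} :
    torsionDefect p a b G x = 0 ↔ G x = torsionGradient N p a b x := by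
  rw [torsionDefect, sub_eq_zero, eq_comm, torsionGradient_eq hp ha,
    inner_eq_norm_rpow_div_add_norm_rpow_div_iff_eq_smul (holderConjugate_div_sub_one hp)]

variable [NeZero N]

theorem continuousOn_torsionSlope (hp : 1 < p) : ContinuousOn (torsionSlope N p a b) (Ioi 0) := by
  have hflux : ContinuousOn (shellFlux N a b) (Ioi 0) := by
    unfold shellFlux
    exact ContinuousOn.div (by fun_prop) (by fun_prop) fun r hr =>
      mul_ne_zero (NeZero.ne _) (pow_ne_zero _ (ne_of_gt hr))
  exact hflux.rpow_const fun _ _ =>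
    Or.inr (holderConjugate_div_sub_one hp).symm.sub_one_pos.le

theorem abs_torsionSlope_le (hp : 1 < p) (ha : 0 ≤ a) (haR : a < R) (hr : r < R) :
    |torsionSlope N p a b r| ≤ R ^ (p / (p - 1) - 1) := by
  have hR : 0 < R := ha.trans_lt haR
  obtain h | h := le_or_gt r a
  · rw [torsionSlope_of_le hp h, abs_zero]
    positivity
  · have hr0 : 0 ≤ r := ha.trans h.le
    rw [abs_of_nonneg (torsionSlope_nonneg ha hr0)]
    exact Real.rpow_le_rpow (shellFlux_nonneg ha hr0)
      ((shellFlux_le_self (NeZero.ne N) ha hr0).trans hr.le)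
      (holderConjugate_div_sub_one hp).symm.sub_one_pos.le

theorem memSobolevZero_torsionFunction (hp : 1 < p) (ha : 0 ≤ a) (haR : a < R) :
    MemSobolevZero p (ball 0 R) (torsionFunction N p a b R) (torsionGradient N p a b) :=
  memSobolevZero_radialPrimitive ha
    ((continuousOn_torsionSlope hp).mono fun _ hr => ha.trans_lt hr.1)
    (fun _ => torsionSlope_of_le hp) (fun _ => abs_torsionSlope_le hp ha haR) (by linarith)

theorem integral_shell_abs_torsionFunction (hp : 1 < p) (ha : 0 ≤ a) (haR : a < R)
    (hbR : b ≤ R) :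
    ∫ x in shell N a b, |torsionFunction N p a b R x| = fluxEnergy N p a b R := by
  have hpq := holderConjugate_div_sub_one hp
  calc ∫ x in shell N a b, |torsionFunction N p a b R x|
      = ∫ x in shell N a b, torsionFunction N p a b R x :=
        setIntegral_congr_fun (measurableSet_shell a b) fun x hx =>
          abs_of_nonneg (torsionFunction_nonneg ha (hx.2.le.trans hbR))
    _ = ∫ x in ball 0 R, ⟪torsionGradient N p a b x, -fluxField N a b x⟫ := by
        simp only [(memSobolevZero_torsionFunction hp ha haR).integral_shell_eq ha hbR hp.le,
          inner_neg_right, integral_neg]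
    _ = fluxEnergy N p a b R := by
        simp only [inner_torsionGradient_neg_fluxField hp ha, norm_torsionGradient_rpow hp ha,
          norm_neg, div_eq_mul_inv _ p, div_eq_mul_inv _ (p / (p - 1)), ← mul_add,
          hpq.inv_add_inv_eq_one, mul_one, fluxEnergy]

theorem integrable_inner_neg_fluxField (hG : Integrable G (volume.restrict (ball 0 R)))
    (ha : 0 ≤ a) :
    Integrable (fun x => ⟪G x, -fluxField N a b x⟫) (volume.restrict (ball 0 R)) := by
  refine (hG.norm.mul_const R).mono' (hG.1.inner (by fun_prop)) ?_
  filter_upwards [ae_norm_fluxField_le (b := b) ha] with x hx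
  rw [← norm_neg] at hx
  exact (norm_inner_le_norm _ _).trans (by gcongr)

theorem integrable_norm_rpow_add_norm_fluxField_rpow (hp : 1 < p) (ha : 0 ≤ a)
    (hG : MemLp G (ENNReal.ofReal p) (volume.restrict (ball 0 R))) :
    Integrable (fun x => ‖G x‖ ^ p / p + ‖-fluxField N a b x‖ ^ (p / (p - 1)) / (p / (p - 1)))
      (volume.restrict (ball 0 R)) :=
  ((integrable_norm_rpow_of_memLp (by linarith) hG).div_const p).add
    ((integrable_norm_rpow_of_memLp (holderConjugate_div_sub_one hp).symm.pos
      (memLp_fluxField ha _).neg).div_const _)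

theorem integrable_torsionDefect (hp : 1 < p) (ha : 0 ≤ a)
    (hG : MemLp G (ENNReal.ofReal p) (volume.restrict (ball 0 R))) :
    Integrable (torsionDefect p a b G) (volume.restrict (ball 0 R)) :=
  (integrable_norm_rpow_add_norm_fluxField_rpow hp ha hG).sub
    (integrable_inner_neg_fluxField (hG.integrable (by simpa using hp.le)) ha)

theorem MemSobolevZero.integral_torsionDefect (h : MemSobolevZero p (ball 0 R) u G)
    (hp : 1 < p) (ha : 0 ≤ a) (hbR : b ≤ R) :
    ∫ x in ball 0 R, torsionDefect p a b G x =
      torsionFunctional p a b R u G + fluxEnergy N p a b R / (p / (p - 1)) := by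
  have hG := h.1.2.1
  have hGp := integrable_norm_rpow_of_memLp (by linarith) hG
  have hXq := integrable_norm_rpow_of_memLp (holderConjugate_div_sub_one hp).symm.pos
    (memLp_fluxField (N := N) (b := b) (R := R) ha _)
  unfold torsionDefect torsionFunctional fluxEnergy
  rw [integral_sub (integrable_norm_rpow_add_norm_fluxField_rpow hp ha hG)
    (integrable_inner_neg_fluxField (hG.integrable (by simpa using hp.le)) ha),
    h.integral_shell_eq ha hbR hp.le]
  simp only [norm_neg, inner_neg_right]
  rw [integral_add (hGp.div_const p) (hXq.div_const _), integral_div, integral_div, integral_neg]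
  ring

theorem isTorsionMinimizer_torsionFunction (hp : 1 < p) (ha : 0 ≤ a) (haR : a < R)
    (hbR : b ≤ R) :
    IsTorsionMinimizer p a b R (torsionFunction N p a b R) (torsionGradient N p a b) := by
  have hV := memSobolevZero_torsionFunction (N := N) (b := b) hp ha haR
  refine ⟨hV, fun φ Dφ hφ => le_of_add_le_add_right (a := fluxEnergy N p a b R / (p / (p - 1))) ?_⟩
  rw [← hV.integral_torsionDefect hp ha hbR, ← hφ.integral_torsionDefect hp ha hbR]
  simp only [(torsionDefect_eq_zero_iff hp ha).2 rfl, integral_zero]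
  exact integral_nonneg (torsionDefect_nonneg hp)

theorem IsTorsionMinimizer.gradient_ae_eq (h : IsTorsionMinimizer p a b R u G) (hp : 1 < p)
    (ha : 0 ≤ a) (haR : a < R) (hbR : b ≤ R) :
    G =ᵐ[volume.restrict (ball 0 R)] torsionGradient N p a b := by
  have hV := memSobolevZero_torsionFunction (N := N) (b := b) hp ha haR
  have hdefect : ∫ x in ball 0 R, torsionDefect p a b G x = 0 := by
    refine le_antisymm ?_ (integral_nonneg (torsionDefect_nonneg hp))
    calc ∫ x in ball 0 R, torsionDefect p a b G x
        ≤ ∫ x in ball 0 R, torsionDefect p a b (torsionGradient N p a b) x := by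
          rw [h.1.integral_torsionDefect hp ha hbR, hV.integral_torsionDefect hp ha hbR]
          exact add_le_add_left (h.2 _ _ hV) _
      _ = 0 := by simp only [(torsionDefect_eq_zero_iff hp ha).2 rfl, integral_zero]
  rw [integral_eq_zero_iff_of_nonneg (torsionDefect_nonneg hp)
    (integrable_torsionDefect hp ha h.1.1.2.1)] at hdefect
  filter_upwards [hdefect] with x hx using (torsionDefect_eq_zero_iff hp ha).1 hx

theorem IsTorsionMinimizer.integral_norm_gradient_rpow (h : IsTorsionMinimizer p a b R u G)
    (hp : 1 < p) (ha : 0 ≤ a) (haR : a < R) (hbR : b ≤ R) :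
    ∫ x in ball 0 R, ‖G x‖ ^ p = fluxEnergy N p a b R := by
  rw [← integral_norm_torsionGradient_rpow hp ha]
  refine integral_congr_ae ?_
  filter_upwards [h.gradient_ae_eq hp ha haR hbR] with x hx
  rw [hx]

theorem MemSobolevZero.ae_eq_zero_of_gradient_ae_eq_zero (h : MemSobolevZero p (ball 0 R) u G)
    (hp : 1 ≤ p) (hG : G =ᵐ[volume.restrict (ball 0 R)] 0) :
    u =ᵐ[volume.restrict (ball 0 R)] 0 := by
  have hu : ∫ x in shell N 0 R, |u x| = 0 := by
    refine le_antisymm ((h.integral_shell_abs_le le_rfl le_rfl hp).trans_eq ?_)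
      (integral_nonneg fun _ => abs_nonneg _)
    refine integral_eq_zero_of_ae ?_
    filter_upwards [hG] with x hx
    simp [hx]
  have hshell : shell N 0 R = ball 0 R \ {0} := by
    ext x
    simp [shell, and_comm]
  rw [hshell, setIntegral_congr_set (sdiff_null_ae_eq_self (measure_singleton 0)),
    integral_eq_zero_iff_of_nonneg (fun _ => abs_nonneg _)
      (h.1.1.integrable (by simpa using hp)).abs] at hu
  filter_upwards [hu] with x hx using abs_eq_zero.1 hx

theorem MemSobolevZero.ae_eq_of_gradient_ae_eq (h : MemSobolevZero p (ball 0 R) u G)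
    (h' : MemSobolevZero p (ball 0 R) u' G') (hp : 1 ≤ p)
    (hG : G =ᵐ[volume.restrict (ball 0 R)] G') : u =ᵐ[volume.restrict (ball 0 R)] u' :=
  (sub_ae_eq_zero _ _).1 <|
    (h.sub hp h').ae_eq_zero_of_gradient_ae_eq_zero hp <| (sub_ae_eq_zero _ _).2 hG

theorem isGreatest_integral_shell_abs_rpow_div (hp : 1 < p) (ha : 0 ≤ a) (hab : a < b)
    (hbR : b < R) :
    IsGreatest {c : ℝ | ∃ (φ : EuclideanSpace ℝ (Fin N) → ℝ)
        (Dφ : EuclideanSpace ℝ (Fin N) → EuclideanSpace ℝ (Fin N)),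
        MemSobolevZero p (ball 0 R) φ Dφ ∧ ¬ (φ =ᵐ[volume.restrict (ball 0 R)] 0) ∧
        c = (∫ x in shell N a b, |φ x|) ^ p / ∫ x in ball 0 R, ‖Dφ x‖ ^ p}
      (fluxEnergy N p a b R ^ (p - 1)) := by
  have hE := fluxEnergy_pos (N := N) hp ha hab hbR
  have hV := integral_shell_abs_torsionFunction (N := N) hp ha (hab.trans hbR) hbR.le
  constructor
  · refine ⟨torsionFunction N p a b R, torsionGradient N p a b,
      memSobolevZero_torsionFunction hp ha (hab.trans hbR), fun hzero => ?_, ?_⟩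
    · refine hE.ne' (hV.symm.trans (integral_eq_zero_of_ae ?_))
      filter_upwards [ae_restrict_of_ae_restrict_of_subset (shell_subset_ball hbR.le) hzero]
        with x hx
      simp [hx]
    · rw [hV, integral_norm_torsionGradient_rpow hp ha, Real.rpow_sub_one hE.ne']
  · rintro _ ⟨φ, Dφ, hφ, -, rfl⟩
    exact div_le_of_le_mul₀ (by positivity) (by positivity)
      (hφ.integral_shell_abs_rpow_le hp ha hbR.le)

end Torsion

theorem mainTheorem5_general {N : ℕ} [NeZero N] {p r₁ r₂ R : ℝ} (hp : 1 < p) (hr₁ : 0 ≤ r₁)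
    (hr₁₂ : r₁ < r₂) (hr₂R : r₂ < R) :
    (∃ (V : EuclideanSpace ℝ (Fin N) → ℝ)
        (DV : EuclideanSpace ℝ (Fin N) → EuclideanSpace ℝ (Fin N)),
      IsTorsionMinimizer p r₁ r₂ R V DV) ∧
    (∀ (V V' : EuclideanSpace ℝ (Fin N) → ℝ)
        (DV DV' : EuclideanSpace ℝ (Fin N) → EuclideanSpace ℝ (Fin N)),
      IsTorsionMinimizer p r₁ r₂ R V DV → IsTorsionMinimizer p r₁ r₂ R V' DV' →
      V =ᵐ[volume.restrict (ball 0 R)] V' ∧ DV =ᵐ[volume.restrict (ball 0 R)] DV') ∧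
    (∀ (V : EuclideanSpace ℝ (Fin N) → ℝ)
        (DV : EuclideanSpace ℝ (Fin N) → EuclideanSpace ℝ (Fin N)),
      IsTorsionMinimizer p r₁ r₂ R V DV →
      IsLUB {c : ℝ | ∃ (φ : EuclideanSpace ℝ (Fin N) → ℝ)
            (Dφ : EuclideanSpace ℝ (Fin N) → EuclideanSpace ℝ (Fin N)),
          MemSobolevZero p (ball 0 R) φ Dφ ∧ ¬ (φ =ᵐ[volume.restrict (ball 0 R)] 0) ∧
          c = (∫ x in shell N r₁ r₂, |φ x|) ^ p / ∫ x in ball 0 R, ‖Dφ x‖ ^ p}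
        ((∫ x in ball 0 R, ‖DV x‖ ^ p) ^ (p - 1)) ∧
      (∫ x in ball 0 R, ‖DV x‖ ^ p) =
        (∫ x in shell N r₁ r₂, (‖x‖ / N * (1 - (r₁ / ‖x‖) ^ N)) ^ (p / (p - 1))) +
          volume.real (shell N r₁ r₂) ^ (p / (p - 1)) *
            (1 / relCapacity p (closedBall (0 : EuclideanSpace ℝ (Fin N)) r₂) (ball 0 R)) ^
              (1 / (p - 1))) ∧
    (∀ (φ : EuclideanSpace ℝ (Fin N) → ℝ)
        (Dφ : EuclideanSpace ℝ (Fin N) → EuclideanSpace ℝ (Fin N)),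
      MemSobolevZero p (ball 0 R) φ Dφ →
      (⨍ x in shell N r₁ r₂, |φ x|) ^ p ≤
        (volume.real (shell N r₁ r₂) /
            (μHE[N - 1].real (sphere (0 : EuclideanSpace ℝ (Fin N)) r₂)) ^ (p / (p - 1)) +
          (1 / relCapacity p (closedBall (0 : EuclideanSpace ℝ (Fin N)) r₂) (ball 0 R)) ^
            (1 / (p - 1))) ^ (p - 1) *
        ∫ x in ball 0 R, ‖Dφ x‖ ^ p) := by
  have hr₁R := hr₁₂.trans hr₂R
  have hr₂ := hr₁.trans_lt hr₁₂
  rw [one_div_relCapacity_closedBall_rpow hp hr₂ hr₂R]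
  refine ⟨⟨_, _, isTorsionMinimizer_torsionFunction hp hr₁ hr₁R hr₂R.le⟩,
    fun V V' DV DV' hV hV' => ?_, fun V DV hV => ?_, fun φ Dφ hφ => ?_⟩
  · have hgrad := (hV.gradient_ae_eq hp hr₁ hr₁R hr₂R.le).trans
      (hV'.gradient_ae_eq hp hr₁ hr₁R hr₂R.le).symm
    exact ⟨hV.1.ae_eq_of_gradient_ae_eq hV'.1 hp.le hgrad, hgrad⟩
  · rw [hV.integral_norm_gradient_rpow hp hr₁ hr₁R hr₂R.le]
    exact ⟨(isGreatest_integral_shell_abs_rpow_div hp hr₁ hr₁₂ hr₂R).isLUB,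
      fluxEnergy_eq hp hr₁ hr₁₂ hr₂R⟩
  · have harea := euclideanHausdorffMeasure_real_sphere_mem_Ioc
      (E := EuclideanSpace ℝ (Fin N)) hr₂
    rw [finrank_euclideanSpace_fin] at harea
    exact hφ.average_shell_abs_rpow_le hp hr₁ hr₁₂ hr₂R harea

theorem mainTheorem5 (N : ℕ) (hN : 2 ≤ N) (p : ℝ) (hp : 1 < p) (hpN : p ≤ N)
    (r₁ r₂ R : ℝ) (hr₁ : 0 < r₁) (hr₁₂ : r₁ < r₂) (hr₂R : r₂ < R) :
    -- existence and uniqueness of the minimizer `V`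
    (∃ (V : EuclideanSpace ℝ (Fin N) → ℝ)
        (DV : EuclideanSpace ℝ (Fin N) → EuclideanSpace ℝ (Fin N)),
      IsTorsionMinimizer p r₁ r₂ R V DV) ∧
    (∀ (V V' : EuclideanSpace ℝ (Fin N) → ℝ)
        (DV DV' : EuclideanSpace ℝ (Fin N) → EuclideanSpace ℝ (Fin N)),
      IsTorsionMinimizer p r₁ r₂ R V DV → IsTorsionMinimizer p r₁ r₂ R V' DV' →
      V =ᵐ[volume.restrict (ball 0 R)] V' ∧ DV =ᵐ[volume.restrict (ball 0 R)] DV') ∧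
    -- the sharp constant and its explicit value
    (∀ (V : EuclideanSpace ℝ (Fin N) → ℝ)
        (DV : EuclideanSpace ℝ (Fin N) → EuclideanSpace ℝ (Fin N)),
      IsTorsionMinimizer p r₁ r₂ R V DV →
      IsLUB {c : ℝ | ∃ (φ : EuclideanSpace ℝ (Fin N) → ℝ)
            (Dφ : EuclideanSpace ℝ (Fin N) → EuclideanSpace ℝ (Fin N)),
          MemSobolevZero p (ball 0 R) φ Dφ ∧ ¬ (φ =ᵐ[volume.restrict (ball 0 R)] 0) ∧
          c = (∫ x in shell N r₁ r₂, |φ x|) ^ p / ∫ x in ball 0 R, ‖Dφ x‖ ^ p}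
        ((∫ x in ball 0 R, ‖DV x‖ ^ p) ^ (p - 1)) ∧
      (∫ x in ball 0 R, ‖DV x‖ ^ p) =
        (∫ x in shell N r₁ r₂, (‖x‖ / N * (1 - (r₁ / ‖x‖) ^ N)) ^ (p / (p - 1))) +
          volume.real (shell N r₁ r₂) ^ (p / (p - 1)) *
            (1 / relCapacity p (closedBall (0 : EuclideanSpace ℝ (Fin N)) r₂) (ball 0 R)) ^
              (1 / (p - 1))) ∧
    -- the resulting Poincaré inequality
    (∀ (φ : EuclideanSpace ℝ (Fin N) → ℝ)
        (Dφ : EuclideanSpace ℝ (Fin N) → EuclideanSpace ℝ (Fin N)),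
      MemSobolevZero p (ball 0 R) φ Dφ →
      (⨍ x in shell N r₁ r₂, |φ x|) ^ p ≤
        (volume.real (shell N r₁ r₂) /
            (μHE[N - 1].real (sphere (0 : EuclideanSpace ℝ (Fin N)) r₂)) ^ (p / (p - 1)) +
          (1 / relCapacity p (closedBall (0 : EuclideanSpace ℝ (Fin N)) r₂) (ball 0 R)) ^
            (1 / (p - 1))) ^ (p - 1) *
        ∫ x in ball 0 R, ‖Dφ x‖ ^ p) := by
  have : NeZero N := ⟨by omega⟩
  exact mainTheorem5_general hp hr₁.le hr₁₂ hr₂R
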